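/- **Setting.** Let $K,N,M,Q,V\ge 1$ be integers with $M\ge N$, and let $c_m,c_s,c_r>0$. There are $N$ input files $\omega_1,\dots,\omega_N$ and $Q$ output functions $u_q=h_q(v_{q,1},\dots,v_{q,N})$, where $v_{q,n}=g_{q,n}(\omega_n)\in\{0,1\}^V$ are the intermediate values. A scheme on nodes $1,\dots,K$ consists of * sets $\mathcal M_k\subseteq\{1,\dots,N\}$ of files mapped by node $k$, with $\bigcup_k\mathcal M_k=\{1,\dots,N\}$ and $\sum_k|\mathcal M_k|\le M$; * a weakly symmetric Reduce assignment with $s=1$: a set $\mathcal K_s$ of solver nodes, with $K_s=|\mathcal K_s|$ dividing $Q$, and a partition of $\{1,\dots,Q\}$ into sets $\mathcal W_k$, $k\in\mathcal K_s$, of equal size $Q/K_s$, with $\mathcal W_k=\emptyset$ for $k\notin\mathcal K_s$; * messages $X_k\in\{0,1\}^{\ell_k}$, where $X_k$ is a function of $(v_{q,n})_{1\le q\le Q,\,n\in\mathcal M_k}$, such that, whatever the Map functions $g_{q,n}$ and the Reduce functions $h_q$ are, each node $k$ can determine $u_q$ for all $q\in\mathcal W_k$ and all file contents from its own intermediate values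 $(v_{q',n})_{1\le q'\le Q,\,n\in\mathcal M_k}$ and all the messages $X_1,\dots,X_K$. Its execution time is $$c_m\max_k\frac{|\mathcal M_k|}{N}+c_s\frac{\sum_k\ell_k}{NQV}+c_r\max_k|\mathcal W_k|.$$ For an integer $K_s\ge1$ let $L_1^*(\cdot,K_s)$ be the lower convex envelope of the points $\bigl(r,\tfrac1r(1-\tfrac r{K_s})\bigr)$, $r\in\{1,\dots,K_s\}$, and $L_2^*(\cdot,K_s)$ that of the points $\bigl(r,\tfrac1{r+1}(1-\tfrac r{K_s})\bigr)$, $r\in\{0,\dots,K_s\}$. Write $\bar\alpha=1-\alpha$. **Statement.** The minimum $$T^*=\min_{(\alpha,r_1,r_2,K_s,K_h)}\; c_m\max\Bigl\{\frac{\alpha r_1+\bar\alpha r_2}{K_s},\frac{\bar\alpha}{K_h}\Bigr\}+c_r\frac Q{K_s}+\alpha c_s L_1^*(r_1,K_s)+\bar\alpha c_s L_2^*(r_2,K_s)$$ exists, where the tuples range over integers $K_s,K_h\ge0$ and reals $\alpha,r_1,r_2$ with $K_s+K_h\le K$, $1\le K_s\le Q$, $K_s\mid Q$, $\alpha r_1+\bar\alpha(r_2+1)\le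 M/N$, $0\le\alpha\le1$, $1\le r_1\le K_s$, $0\le r_2\le K_s$, and where $\alpha=1$ if $K_h=0$ (in which case $\bar\alpha/K_h$ is read as $0$). $T^*$ is the minimum execution time with $s=1$ under the weakly symmetric Reduce assignment, in the following sense. 1. For all integers $m,V\ge1$, every scheme with $mN$ files and total storage $mM$ has execution time at least $T^*$ (in particular this holds for $m=1$). 2. There is an integer $m_0\ge1$ such that for every positive multiple $m$ of $m_0$ and every $V\ge1$, the minimum execution time over all schemes with $mN$ files and total storage $mM$ exists and equals $T^*$. Moreover, at every feasible tuple with integers $r_1,r_2$ the minimized expression equals $$c_m\max\Bigl\{\frac{\alpha r_1+\bar\alpha r_2}{K_s},\frac{\bar\alpha}{K_h}\Bigr\}+c_r\frac Q{K_s}+\alpha c_s\frac1{r_1}\Bigl(1-\frac{r_1}{K_s}\Bigr)+\bar\alpha c_s\frac1{r_2+1}\Bigl(1-\frac{r_2}{K_s}\Bigr).$$ -/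

import Mathlib

open Finset

namespace MapReduce

/-- Bit strings of length `n` (the elements of the field with `2 ^ n` elements, as data). -/
abbrev Bits (n : ℕ) : Type := Fin n → Bool

/-- A MapReduce task with `N` input files, `Q` output functions and intermediate values of `V` bits:
the Map functions `g q n` and the Reduce functions `h q`. -/
structure Task (N Q V : ℕ) where
  F : ℕ
  B : ℕ
  g : Fin Q → Fin N → Bits F → Bits V
  h : Fin Q → (Fin N → Bits V) → Bits B

namespace Task

variable {N Q V : ℕ}

/-- The intermediate value `v q n = g q n (ω n)`. -/
def interm (t : Task N Q V) (ω : Fin N → Bits t.F) (q : Fin Q) (n : Fin N) : Bits V :=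
  t.g q n (ω n)

/-- The output value `u q = h q (v q 1, …, v q N)`. -/
def output (t : Task N Q V) (ω : Fin N → Bits t.F) (q : Fin Q) : Bits t.B :=
  t.h q (t.interm ω q)

end Task

/-- Weakly symmetric Reduce assignment with parameter `s` and set of solvers `S`: the `Q` Reduce
functions are split into disjoint batches `D P` of equal size `Q / (#S choose s)`, one for each
`P ⊆ S` with `s` elements, and node `k` computes the functions in `D P` exactly for the `P`
containing `k` (so a node outside `S` computes nothing). -/
def IsWeaklySymmetric {K Q : ℕ} (s : ℕ) (S : Finset (Fin K)) (W : Fin K → Finset (Fin Q)) : Prop :=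
  ∃ D : Finset (Fin K) → Finset (Fin Q),
    (∀ P ∈ S.powersetCard s, #(D P) * (#S).choose s = Q) ∧
    (∀ P ∈ S.powersetCard s, ∀ P' ∈ S.powersetCard s, P ≠ P' → Disjoint (D P) (D P')) ∧
    (S.powersetCard s).biUnion D = univ ∧
    ∀ k, W k = ((S.powersetCard s).filter (fun P => k ∈ P)).biUnion D

/-- A Map-Shuffle-Reduce scheme on `K` nodes with `N` files, total storage of `M` files, `Q` output
functions, intermediate values of `V` bits, and a weakly symmetric Reduce assignment with
parameter `s`. -/
structure Scheme (K N M Q V s : ℕ) where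
  /-- the files mapped by node `k` -/
  files : Fin K → Finset (Fin N)
  files_cover : ∀ n, ∃ k, n ∈ files k
  storage : ∑ k, #(files k) ≤ M
  /-- the nodes that produce Reduce functions -/
  solvers : Finset (Fin K)
  /-- the Reduce functions assigned to node `k` -/
  reduce : Fin K → Finset (Fin Q)
  reduce_symmetric : IsWeaklySymmetric s solvers reduce
  /-- the number of bits multicast by node `k` -/
  len : Fin K → ℕ
  /-- the message of node `k`, a function of the intermediate values it has mapped -/
  encode : (k : Fin K) → (Fin Q → {n // n ∈ files k} → Bits V) → Bits (len k)
  /-- Whatever the Map and Reduce functions are, every node can produce its assigned output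
  values, for all contents of the files, from its own intermediate values and all messages. -/
  correct : ∀ (t : Task N Q V) (k : Fin K), ∀ q ∈ reduce k,
    ∃ decode : (Fin Q → {n // n ∈ files k} → Bits V) → ((i : Fin K) → Bits (len i)) → Bits t.B,
      ∀ ω : Fin N → Bits t.F,
        decode (fun q' n => t.interm ω q' n)
          (fun i => encode i (fun q' n => t.interm ω q' n)) = t.output ω q

namespace Scheme

variable {K N M Q V s : ℕ}

/-- Peak computation load `p = max_k |M_k| / N`. -/
noncomputable def peakLoad (σ : Scheme K N M Q V s) : ℝ :=
  ((univ.sup fun k => #(σ.files k) : ℕ) : ℝ) / N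

/-- Communication load `L = (∑_k ℓ_k) / (N Q V)`. -/
noncomputable def commLoad (σ : Scheme K N M Q V s) : ℝ :=
  ((∑ k, σ.len k : ℕ) : ℝ) / ((N : ℝ) * Q * V)

/-- Execution time: Map time plus Shuffle time plus Reduce time. -/
noncomputable def execTime (cm cs cr : ℝ) (σ : Scheme K N M Q V s) : ℝ :=
  cm * σ.peakLoad + cs * σ.commLoad + cr * ((univ.sup fun k => #(σ.reduce k) : ℕ) : ℝ)

end Scheme

/-- The set of achievable execution times. -/
def achievableTimes (K N M Q V s : ℕ) (cm cs cr : ℝ) : Set ℝ :=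
  Set.range fun σ : Scheme K N M Q V s => σ.execTime cm cs cr

/-- The lower convex envelope at `x` of a finite set of points of the plane: the height of the lower
boundary of their convex hull above `x`. Only used for `x` in the range of abscissas. -/
noncomputable def lowerConvexEnvelope (P : Set (ℝ × ℝ)) (x : ℝ) : ℝ :=
  sInf {y | (x, y) ∈ convexHull ℝ P}

/-- Communication load `(1 / r) (1 - r / Ks)` without helpers. -/
noncomputable def load1 (Ks : ℕ) (r : ℝ) : ℝ := 1 / r * (1 - r / Ks)

/-- Communication load `(1 / (r + 1)) (1 - r / Ks)` with helpers. -/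
noncomputable def load2 (Ks : ℕ) (r : ℝ) : ℝ := 1 / (r + 1) * (1 - r / Ks)

/-- Lower convex envelope of the points `(r, load1 Ks r)`, `r = 1, …, Ks`
(the load at `r = 0` is infinite). -/
noncomputable def load1Env (Ks : ℕ) : ℝ → ℝ :=
  lowerConvexEnvelope {p | ∃ r : ℕ, 1 ≤ r ∧ r ≤ Ks ∧ p = ((r : ℝ), load1 Ks r)}

/-- Lower convex envelope of the points `(r, load2 Ks r)`, `r = 0, …, Ks`. -/
noncomputable def load2Env (Ks : ℕ) : ℝ → ℝ :=
  lowerConvexEnvelope {p | ∃ r : ℕ, r ≤ Ks ∧ p = ((r : ℝ), load2 Ks r)}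

/-- A resource allocation `(α, r₁, r₂, K_s, K_h)`. -/
structure Allocation where
  α : ℝ
  r₁ : ℝ
  r₂ : ℝ
  Ks : ℕ
  Kh : ℕ

/-- The constraints on a resource allocation. Without helpers, `(1 - α) / K_h` is finite
only for `α = 1`. -/
structure Allocation.Feasible (K N M Q : ℕ) (a : Allocation) : Prop where
  nodes : a.Ks + a.Kh ≤ K
  one_le_Ks : 1 ≤ a.Ks
  Ks_le : a.Ks ≤ Q
  Ks_dvd : a.Ks ∣ Q
  storage : a.α * a.r₁ + (1 - a.α) * (a.r₂ + 1) ≤ (M : ℝ) / N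
  α_nonneg : 0 ≤ a.α
  α_le_one : a.α ≤ 1
  no_helper : a.Kh = 0 → a.α = 1
  one_le_r₁ : 1 ≤ a.r₁
  r₁_le : a.r₁ ≤ a.Ks
  r₂_nonneg : 0 ≤ a.r₂
  r₂_le : a.r₂ ≤ a.Ks

/-- The time expression with given communication load functions `ℓ₁`, `ℓ₂` (depending on `K_s`). -/
noncomputable def Allocation.time (ℓ₁ ℓ₂ : ℕ → ℝ → ℝ) (Q : ℕ) (cm cs cr : ℝ) (a : Allocation) : ℝ :=
  cm * max ((a.α * a.r₁ + (1 - a.α) * a.r₂) / a.Ks) ((1 - a.α) / a.Kh) + cr * ((Q : ℝ) / a.Ks)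
    + a.α * cs * ℓ₁ a.Ks a.r₁ + (1 - a.α) * cs * ℓ₂ a.Ks a.r₂

end MapReduce

/-!
The proof compares schemes and resource allocations with a third kind of object, *mixtures*
(`IsMixture`): the fractions `a j` of files mapped by `j` solvers and no helper, and `b j` of files
mapped by `j` solvers and a helper, for given numbers of solvers and helpers. The time of a mixture
is the maximum of two linear functions plus a linear function, and no envelopes occur in it. Taking
means turns a mixture into an allocation that is at least as fast (`IsMixture.exists_allocation`),
and since the lower convex envelopes are attained, every allocation comes from a mixture of the same
time (`Allocation.Feasible.exists_mixture`). So the minimum over allocations is the minimum over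
mixtures, a piecewise linear minimisation over finitely many polytopes with rational data. It is
attained at a *rational* mixture (`exists_rational_minimiser`, `exists_fastest_mixture`) even though
the cost coefficients are real: an irrational minimiser could be moved both ways along its image
under a `ℚ`-linear functional on `ℝ` that kills `1`, so it would not be an extreme point of the set
of minimisers.

Lower bound. All nodes that are not solvers are merged into one node that reduces nothing; this
does not affect decodability. Take the intermediate values independent and uniform, let `A n` be the
set of (merged) nodes mapping file `n`, and let `g S` be the entropy of all messages given
everything known to or demanded by the nodes outside `S`. Subadditivity and submodularity of entropy give
`(#S - 1) * g S ≥ ∑ k ∈ S, (g (S \ {k}) + demand of k for files mapped only inside S \ {k})`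
(`converse_step`), and by induction `g S` is at least the sum, over the files `n` with `A n ⊆ S`, of
the demand of the nodes in `S \ A n` for `n`, divided by `#(A n)` (`converse_subset`). For the set
of all nodes a file mapped by `j` of the `Ks` solvers thus costs `(1 - j / Ks) / j` without and
`(1 - j / Ks) / (j + 1)` with a helper, in units of the total demand for the file, so that a scheme
is no faster than its mixture (`Scheme.mixtureTime_le_execTime`).

Achievability. A rational mixture is realised by coded multicasting once the number of files is
divisible by a common denominator (`IsMixture.exists_scheme`). Each file is assigned to a set `T` of
solvers and designated to one sender `x`, a member of `T` or a helper. For each set `U` of solvers,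
`x` sends the exclusive or, over `k ∈ U` with `k ≠ x`, of what `k` demands from the files assigned
to `U \ {k}` and designated to `x`; node `k` knows every other term (`coded_decode`). Splitting
whole files between the senders, instead of splitting intermediate values, makes this work for
every `V`.
-/

namespace MapReduce

/-! ### Entropy of equivalence relations on a finite uniform probability space -/

section Entropy

open scoped Classical in
/-- The number of elements of the class of `ω`. -/
noncomputable def classCard {Ω : Type*} [Fintype Ω] (r : Setoid Ω) (ω : Ω) : ℕ :=
  #{ω' | r ω ω'}

/-- Shannon entropy, in nats, of the class of a uniformly distributed element of `Ω`. A random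
variable `f` on `Ω` is represented by the relation `Setoid.ker f`, so that the infimum of two
relations is the joint variable and `r ≤ s` says that `r` determines `s`. -/
noncomputable def entropy {Ω : Type*} [Fintype Ω] (r : Setoid Ω) : ℝ :=
  (∑ ω, Real.log ((Fintype.card Ω : ℝ) / classCard r ω)) / Fintype.card Ω

variable {Ω : Type*} [Fintype Ω]

lemma classCard_pos (r : Setoid Ω) (ω : Ω) : 0 < classCard r ω := by
  classical
  exact Finset.card_pos.2 ⟨ω, by simp⟩

lemma classCard_congr {r : Setoid Ω} {ω ω' : Ω} (h : r ω ω') :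
    classCard r ω = classCard r ω' := by
  classical
  unfold classCard
  congr 1
  ext x
  simp only [mem_filter, mem_univ, true_and]
  exact ⟨fun hx => r.trans (r.symm h) hx, fun hx => r.trans h hx⟩

lemma classCard_mono {r s : Setoid Ω} (h : r ≤ s) (ω : Ω) : classCard r ω ≤ classCard s ω := by
  classical
  refine Finset.card_le_card fun x hx => ?_
  simp only [mem_filter, mem_univ, true_and] at hx ⊢
  exact h hx

lemma entropy_anti {r s : Setoid Ω} (h : r ≤ s) : entropy s ≤ entropy r := by
  unfold entropy
  gcongr with ω
  · have := classCard_pos s ω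
    have : 0 < Fintype.card Ω := Fintype.card_pos_iff.2 ⟨ω⟩
    positivity
  · exact_mod_cast classCard_pos r ω
  · exact classCard_mono h ω

lemma entropy_top [Nonempty Ω] : entropy (⊤ : Setoid Ω) = 0 := by
  classical
  have h : (Fintype.card Ω : ℝ) ≠ 0 := by exact_mod_cast Fintype.card_ne_zero
  have h2 : ∀ ω : Ω, classCard (⊤ : Setoid Ω) ω = Fintype.card Ω := by
    intro ω
    rw [classCard, Finset.filter_true_of_mem (p := fun x => (⊤ : Setoid Ω) ω x) fun x _ => trivial,
      Finset.card_univ]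
  simp [entropy, h2, h]

/-- The quotient set has at most as many elements as the codomain of any variable inducing `r`. -/
lemma sum_inv_classCard_ker_le {β : Type*} [Fintype β] (f : Ω → β) :
    ∑ ω, (1 : ℝ) / classCard (Setoid.ker f) ω ≤ Fintype.card β := by
  classical
  rw [← Finset.sum_fiberwise (s := univ) (g := f)]
  have h : ∀ b : β, ∑ ω with f ω = b, (1 : ℝ) / classCard (Setoid.ker f) ω ≤ 1 := by
    intro b
    have h1 : ∀ ω ∈ (univ.filter fun ω => f ω = b),
        (1 : ℝ) / classCard (Setoid.ker f) ω = 1 / #{ω | f ω = b} := by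
      intro ω hω
      simp only [mem_filter, mem_univ, true_and] at hω
      unfold classCard
      congr 3
      ext x
      simp [Setoid.ker_def, hω, eq_comm]
    rw [Finset.sum_congr rfl h1, Finset.sum_const, nsmul_eq_mul, mul_one_div]
    exact div_self_le_one _
  calc _ ≤ ∑ _b : β, (1 : ℝ) := Finset.sum_le_sum fun b _ => h b
    _ = _ := by simp

lemma entropy_ker_le_log_card {β : Type*} [Fintype β] [Nonempty Ω] (f : Ω → β) :
    entropy (Setoid.ker f) ≤ Real.log (Fintype.card β) := by
  have hβ : Nonempty β := ⟨f (Classical.arbitrary Ω)⟩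
  have hΩ : (0 : ℝ) < Fintype.card Ω := by exact_mod_cast Fintype.card_pos
  have hb : (0 : ℝ) < Fintype.card β := by exact_mod_cast Fintype.card_pos
  unfold entropy
  rw [div_le_iff₀ hΩ]
  have key : ∀ ω : Ω, Real.log ((Fintype.card Ω : ℝ) / classCard (Setoid.ker f) ω) ≤
      Real.log (Fintype.card β) +
        ((Fintype.card Ω : ℝ) / Fintype.card β * (1 / classCard (Setoid.ker f) ω) - 1) := by
    intro ω
    have hc : (0 : ℝ) < classCard (Setoid.ker f) ω := by exact_mod_cast classCard_pos _ ω
    have h := Real.log_le_sub_one_of_pos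
      (show 0 < (Fintype.card Ω : ℝ) / Fintype.card β * (1 / classCard (Setoid.ker f) ω) by
        positivity)
    have e : (Fintype.card Ω : ℝ) / classCard (Setoid.ker f) ω = Fintype.card β *
        ((Fintype.card Ω : ℝ) / Fintype.card β * (1 / classCard (Setoid.ker f) ω)) := by
      field_simp
    rw [e, Real.log_mul hb.ne' (by positivity)]
    linarith
  calc _ ≤ _ := Finset.sum_le_sum fun ω _ => key ω
    _ = Real.log (Fintype.card β) * Fintype.card Ω + ((Fintype.card Ω : ℝ) / Fintype.card β *
        ∑ ω, (1 : ℝ) / classCard (Setoid.ker f) ω - Fintype.card Ω) := by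
      rw [Finset.sum_add_distrib, Finset.sum_sub_distrib, ← Finset.mul_sum]
      simp [mul_comm]
    _ ≤ Real.log (Fintype.card β) * Fintype.card Ω + ((Fintype.card Ω : ℝ) / Fintype.card β *
        Fintype.card β - Fintype.card Ω) := by
      gcongr
      exact sum_inv_classCard_ker_le f
    _ = _ := by field_simp; ring

/-- The counting form of the conditional independence bound behind submodularity. -/
lemma sum_classCard_ratio_le {r s t : Setoid Ω} (hr : r ≤ t) (hs : s ≤ t) :
    ∑ ω, (classCard r ω * classCard s ω : ℝ) / (classCard (r ⊓ s) ω * classCard t ω) ≤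
      Fintype.card Ω := by
  classical
  -- Expand the two numerators into a sum over pairs `(x, y)` and exchange the sums.
  have h1 : ∀ ω, (classCard r ω * classCard s ω : ℝ) / (classCard (r ⊓ s) ω * classCard t ω) =
      ∑ x, ∑ y, if r ω x ∧ s ω y then
        (1 : ℝ) / (classCard (r ⊓ s) ω * classCard t ω) else 0 := by
    intro ω
    have : ∀ x, (∑ y, if r ω x ∧ s ω y then
        (1 : ℝ) / (classCard (r ⊓ s) ω * classCard t ω) else 0) =
        if r ω x then classCard s ω * ((1 : ℝ) / (classCard (r ⊓ s) ω * classCard t ω)) else 0 := by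
      intro x
      by_cases hx : r ω x
      · simp only [hx, true_and, if_true]
        rw [← Finset.sum_filter, Finset.sum_const, nsmul_eq_mul]
        rfl
      · simp [hx]
    simp_rw [this]
    rw [← Finset.sum_filter, Finset.sum_const, nsmul_eq_mul, div_eq_mul_one_div, mul_assoc]
    rfl
  simp_rw [h1]
  rw [Finset.sum_comm]
  have h2 : ∀ x, ∑ ω, ∑ y, (if r ω x ∧ s ω y then
      (1 : ℝ) / (classCard (r ⊓ s) ω * classCard t ω) else 0) ≤ 1 := by
    intro x
    rw [Finset.sum_comm]
    -- Only the `y` in the class of `x` for `t` contribute, each at most `1 / classCard t x`.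
    have h3 : ∀ y, ∑ ω, (if r ω x ∧ s ω y then
        (1 : ℝ) / (classCard (r ⊓ s) ω * classCard t ω) else 0) ≤
        if t x y then 1 / (classCard t x : ℝ) else 0 := by
      intro y
      by_cases hne : ∃ ω₀, r ω₀ x ∧ s ω₀ y
      · obtain ⟨ω₀, hx, hy⟩ := hne
        have hxy : t x y := t.trans (t.symm (hr hx)) (hs hy)
        rw [if_pos hxy, ← Finset.sum_filter]
        have hset : (univ.filter fun ω => r ω x ∧ s ω y) =
            univ.filter fun ω => (r ⊓ s) ω₀ ω := by
          ext ω
          simp only [mem_filter, mem_univ, true_and]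
          exact ⟨fun h => ⟨r.trans hx (r.symm h.1), s.trans hy (s.symm h.2)⟩,
            fun h => ⟨r.trans (r.symm h.1) hx, s.trans (s.symm h.2) hy⟩⟩
        rw [hset]
        have h4 : ∀ ω ∈ (univ.filter fun ω => (r ⊓ s) ω₀ ω),
            (1 : ℝ) / (classCard (r ⊓ s) ω * classCard t ω) =
              1 / (classCard (r ⊓ s) ω₀ * classCard t x) := by
          intro ω hω
          simp only [mem_filter, mem_univ, true_and] at hω
          rw [← classCard_congr hω,
            classCard_congr (t.trans (t.symm (hr hω.1)) (hr hx) : t ω x)]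
        rw [Finset.sum_congr rfl h4, Finset.sum_const, nsmul_eq_mul]
        have hc : (0 : ℝ) < classCard (r ⊓ s) ω₀ := by exact_mod_cast classCard_pos _ _
        have : (#(univ.filter fun ω => (r ⊓ s) ω₀ ω) : ℝ) = classCard (r ⊓ s) ω₀ := rfl
        rw [this]
        apply le_of_eq
        field_simp
      · push Not at hne
        rw [Finset.sum_eq_zero]
        · split_ifs <;> positivity
        · intro ω _
          rw [if_neg fun h => hne ω h.1 h.2]
    calc _ ≤ _ := Finset.sum_le_sum fun y _ => h3 y
      _ = (classCard t x : ℝ) * (1 / classCard t x) := by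
        rw [← Finset.sum_filter, Finset.sum_const, nsmul_eq_mul]
        rfl
      _ ≤ 1 := by
        rw [mul_one_div]
        exact div_self_le_one _
  calc _ ≤ ∑ _x : Ω, (1 : ℝ) := Finset.sum_le_sum fun x _ => h2 x
    _ = _ := by simp

/-- Submodularity of entropy: conditioned on `t`, the joint variable has at most the sum of the
entropies. -/
theorem entropy_submodular {r s t : Setoid Ω} (hr : r ≤ t) (hs : s ≤ t) :
    entropy (r ⊓ s) + entropy t ≤ entropy r + entropy s := by
  rcases isEmpty_or_nonempty Ω with hΩ | hΩ
  · simp [entropy]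
  have hc : (0 : ℝ) < Fintype.card Ω := by exact_mod_cast Fintype.card_pos
  unfold entropy
  rw [← add_div, ← add_div, ← Finset.sum_add_distrib, ← Finset.sum_add_distrib]
  gcongr ?_ / _
  rw [← sub_nonpos, ← Finset.sum_sub_distrib]
  have key : ∀ ω, (Real.log ((Fintype.card Ω : ℝ) / classCard (r ⊓ s) ω) +
      Real.log ((Fintype.card Ω : ℝ) / classCard t ω)) -
      (Real.log ((Fintype.card Ω : ℝ) / classCard r ω) +
        Real.log ((Fintype.card Ω : ℝ) / classCard s ω)) ≤
      (classCard r ω * classCard s ω : ℝ) / (classCard (r ⊓ s) ω * classCard t ω) - 1 := by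
    intro ω
    have h1 : (0 : ℝ) < classCard r ω := by exact_mod_cast classCard_pos _ ω
    have h2 : (0 : ℝ) < classCard s ω := by exact_mod_cast classCard_pos _ ω
    have h3 : (0 : ℝ) < classCard t ω := by exact_mod_cast classCard_pos _ ω
    have h4 : (0 : ℝ) < classCard (r ⊓ s) ω := by exact_mod_cast classCard_pos _ ω
    have h := Real.log_le_sub_one_of_pos (show 0 < (classCard r ω * classCard s ω : ℝ) /
      (classCard (r ⊓ s) ω * classCard t ω) by positivity)
    rw [Real.log_div (by positivity) (by positivity), Real.log_mul h1.ne' h2.ne',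
      Real.log_mul h4.ne' h3.ne'] at h
    rw [Real.log_div hc.ne' h1.ne', Real.log_div hc.ne' h2.ne', Real.log_div hc.ne' h3.ne',
      Real.log_div hc.ne' h4.ne']
    linarith
  calc _ ≤ _ := Finset.sum_le_sum fun ω _ => key ω
    _ = (∑ ω, (classCard r ω * classCard s ω : ℝ) / (classCard (r ⊓ s) ω * classCard t ω)) -
        Fintype.card Ω := by
      rw [Finset.sum_sub_distrib]
      simp
    _ ≤ 0 := by linarith [sum_classCard_ratio_le hr hs]

/-- Subadditivity of conditional entropy over a finite family. -/
lemma entropy_iInf_inf_le {ι : Type*} (X : ι → Setoid Ω) (t : Setoid Ω) (S : Finset ι) :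
    entropy ((⨅ i ∈ S, X i) ⊓ t) - entropy t ≤ ∑ i ∈ S, (entropy (X i ⊓ t) - entropy t) := by
  classical
  induction S using Finset.induction_on with
  | empty => simp
  | insert i S hi ih =>
    rw [Finset.sum_insert hi, Finset.iInf_insert]
    have h := entropy_submodular (r := X i ⊓ t) (s := (⨅ i ∈ S, X i) ⊓ t) (t := t)
      inf_le_right inf_le_right
    rw [← inf_inf_distrib_right] at h
    linarith

/-- The relation of agreeing on the coordinates in `C`. -/
def agreeOn {κ β : Type*} (C : Finset κ) : Setoid (κ → β) where
  r v v' := ∀ c ∈ C, v c = v' c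
  iseqv := ⟨fun _ _ _ => rfl, fun h c hc => (h c hc).symm,
    fun h h' c hc => (h c hc).trans (h' c hc)⟩

lemma agreeOn_empty {κ β : Type*} : (agreeOn ∅ : Setoid (κ → β)) = ⊤ := by
  ext v v'
  exact ⟨fun _ => trivial, fun _ c hc => absurd hc (Finset.notMem_empty c)⟩

lemma agreeOn_union {κ β : Type*} [DecidableEq κ] (C D : Finset κ) :
    (agreeOn (C ∪ D) : Setoid (κ → β)) = agreeOn C ⊓ agreeOn D := by
  ext v v'
  change (∀ c ∈ C ∪ D, v c = v' c) ↔ (∀ c ∈ C, v c = v' c) ∧ (∀ c ∈ D, v c = v' c)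
  simp only [mem_union, or_imp, forall_and]

lemma agreeOn_anti {κ β : Type*} {C D : Finset κ} (h : C ⊆ D) :
    (agreeOn D : Setoid (κ → β)) ≤ agreeOn C :=
  fun _ _ hv c hc => hv c (h hc)

lemma entropy_agreeOn {κ β : Type*} [Fintype κ] [DecidableEq κ] [Fintype β] [Nonempty β]
    (C : Finset κ) :
    entropy (agreeOn C : Setoid (κ → β)) = #C * Real.log (Fintype.card β) := by
  classical
  have hb : (0 : ℝ) < Fintype.card β := by exact_mod_cast Fintype.card_pos
  have h : ∀ v : κ → β, (Fintype.card (κ → β) : ℝ) / classCard (agreeOn C) v =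
      (Fintype.card β : ℝ) ^ #C := by
    intro v
    have h1 : classCard (agreeOn C) v = Fintype.card β ^ #Cᶜ := by
      have : (univ.filter fun v' => (agreeOn C : Setoid (κ → β)) v v') =
          Fintype.piFinset fun c => if c ∈ C then {v c} else univ := by
        ext v'
        simp only [mem_filter, mem_univ, true_and, Fintype.mem_piFinset]
        refine forall_congr' fun c => ?_
        by_cases hc : c ∈ C <;> simp [hc, eq_comm]
      rw [classCard, this, Fintype.card_piFinset, ← Finset.prod_mul_prod_compl C]
      rw [Finset.prod_congr rfl (g := fun _ => 1) fun c hc => by simp [hc],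
        Finset.prod_congr rfl (s₁ := Cᶜ) (g := fun _ => Fintype.card β) fun c hc => by
          rw [if_neg (Finset.mem_compl.1 hc), Finset.card_univ]]
      simp
    rw [h1, Fintype.card_fun, ← Finset.card_add_card_compl C, pow_add]
    push_cast
    field_simp
  have hne : (Fintype.card (κ → β) : ℝ) ≠ 0 := by exact_mod_cast Fintype.card_ne_zero
  simp only [entropy, h, Real.log_pow, Finset.sum_const, Finset.card_univ, nsmul_eq_mul]
  field_simp

end Entropy

/-! ### The information-theoretic converse -/

section Converse

variable {ι ν β γ : Type*} [DecidableEq ν]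

/-- The nodes that map the file `n`. -/
def mappers [Fintype ι] (M : ι → Finset ν) (n : ν) : Finset ι := {i | n ∈ M i}

lemma mem_mappers [Fintype ι] {M : ι → Finset ν} {n : ν} {i : ι} : i ∈ mappers M n ↔ n ∈ M i := by
  simp [mappers]

variable [Fintype ν] [Fintype β] [DecidableEq β]

/-- The intermediate values known to, or demanded by, some node of `T`. -/
def knownBy (M : ι → Finset ν) (W : ι → Finset β) (T : Finset ι) : Finset (β × ν) :=
  T.biUnion fun i => univ ×ˢ M i ∪ W i ×ˢ univ

lemma agreeOn_knownBy_le {M : ι → Finset ν} {W : ι → Finset β} {T : Finset ι} {i : ι}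
    (hi : i ∈ T) : (agreeOn (knownBy M W T) : Setoid (β × ν → γ)) ≤ agreeOn (univ ×ˢ M i) := by
  refine agreeOn_anti fun x hx => ?_
  exact Finset.mem_biUnion.2 ⟨i, hi, Finset.mem_union_left _ hx⟩

variable [DecidableEq ι]

/-- A file known exactly to the nodes in `A` contributes `(∑ k ∈ S \ A, w k) / #A` to the load among
the nodes of `S ⊇ A`. This is the recursion satisfied by these contributions when single nodes are
removed from `S`. -/
lemma converse_recursion (S A : Finset ι) (w : ι → ℝ) (hA : A.Nonempty) :
    ∑ k ∈ S, (if A ⊆ S.erase k then w k + (∑ i ∈ S.erase k \ A, w i) / #A else 0) =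
      (#S - 1) * (if A ⊆ S then (∑ i ∈ S \ A, w i) / #A else 0) := by
  by_cases hAS : A ⊆ S
  · have ha : (#A : ℝ) ≠ 0 := by exact_mod_cast hA.card_pos.ne'
    rw [if_pos hAS]
    have h1 : ∀ k ∈ S, (if A ⊆ S.erase k then w k + (∑ i ∈ S.erase k \ A, w i) / #A else 0) =
        if k ∈ S \ A then w k + ((∑ i ∈ S \ A, w i) - w k) / #A else 0 := by
      intro k hk
      by_cases hkA : k ∈ A
      · rw [if_neg, if_neg] <;> simp [Finset.subset_erase, hkA]
      · have hmem : k ∈ S \ A := by simp [hk, hkA]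
        rw [if_pos (Finset.subset_erase.2 ⟨hAS, hkA⟩), if_pos hmem, Finset.erase_sdiff_comm,
          ← Finset.sum_erase_add _ _ hmem]
        simp
    rw [Finset.sum_congr rfl h1, ← Finset.sum_filter,
      Finset.filter_mem_eq_inter, Finset.inter_eq_right.2 Finset.sdiff_subset,
      Finset.sum_add_distrib, ← Finset.sum_div, Finset.sum_sub_distrib, Finset.sum_const,
      nsmul_eq_mul, Finset.card_sdiff_of_subset hAS, Nat.cast_sub (Finset.card_le_card hAS)]
    field_simp
    ring
  · rw [if_neg hAS, mul_zero]
    refine Finset.sum_eq_zero fun k _ => if_neg fun h => hAS (h.trans (Finset.erase_subset _ _))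

variable [Fintype ι]

/-- After learning what node `k` maps, the demand of node `k` that is still unknown concerns the
files mapped only by the other nodes of `S`. -/
lemma card_knownBy_erase_ge (M : ι → Finset ν) (W : ι → Finset β)
    (hW : ∀ i j, i ≠ j → Disjoint (W i) (W j)) {S : Finset ι} {k : ι} (hk : k ∈ S) :
    #(knownBy M W Sᶜ ∪ univ ×ˢ M k) + #(W k) * #{n | mappers M n ⊆ S.erase k} ≤
      #(knownBy M W Sᶜ ∪ univ ×ˢ M k ∪ W k ×ˢ univ) := by
  rw [← Finset.card_product, ← Finset.card_union_of_disjoint]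
  · refine Finset.card_le_card (Finset.union_subset_union_right ?_)
    exact Finset.product_subset_product_right (Finset.subset_univ _)
  · rw [Finset.disjoint_left]
    rintro ⟨q, n⟩ h1 h2
    simp only [mem_product, mem_filter, mem_univ, true_and] at h2
    rcases Finset.mem_union.1 h1 with h | h
    · obtain ⟨i, hi, h⟩ := Finset.mem_biUnion.1 h
      have hiS : i ∉ S := by simpa using hi
      rcases Finset.mem_union.1 h with h | h
      · have : i ∈ S.erase k := h2.2 (mem_mappers.2 (Finset.mem_product.1 h).2)
        exact hiS (Finset.mem_of_mem_erase this)
      · have hik : i ≠ k := fun e => hiS (e ▸ hk)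
        exact Finset.disjoint_left.1 (hW i k hik) (Finset.mem_product.1 h).1 h2.1
    · have : k ∈ S.erase k := h2.2 (mem_mappers.2 (Finset.mem_product.1 h).2)
      exact Finset.notMem_erase k S this

/-- One step of the converse: removing each node of `S` in turn. -/
lemma converse_step [Fintype γ] [Nonempty γ]
    (X : ι → Setoid (β × ν → γ)) (M : ι → Finset ν) (W : ι → Finset β)
    (hW : ∀ i j, i ≠ j → Disjoint (W i) (W j))
    (hX : ∀ i, agreeOn (univ ×ˢ M i) ≤ X i)
    (hdec : ∀ i, (⨅ i, X i) ⊓ agreeOn (univ ×ˢ M i) ≤ agreeOn (W i ×ˢ univ)) (S : Finset ι) :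
    ∑ k ∈ S, (Real.log (Fintype.card γ) * (#(W k) * #{n | mappers M n ⊆ S.erase k} : ℝ) +
        (entropy ((⨅ i, X i) ⊓ agreeOn (knownBy M W (S.erase k)ᶜ)) -
          entropy (agreeOn (knownBy M W (S.erase k)ᶜ) : Setoid (β × ν → γ)))) ≤
      (#S - 1) * (entropy ((⨅ i, X i) ⊓ agreeOn (knownBy M W Sᶜ)) -
        entropy (agreeOn (knownBy M W Sᶜ) : Setoid (β × ν → γ))) := by
  set Xa := ⨅ i, X i with hXa
  set Y : Finset (β × ν) → Setoid (β × ν → γ) := fun C => agreeOn C with hY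
  set C := knownBy M W Sᶜ with hC
  have hlog : 0 ≤ Real.log (Fintype.card γ) := Real.log_natCast_nonneg _
  -- Messages from outside `S` are functions of what is revealed.
  have ha : entropy (Xa ⊓ Y C) - entropy (Y C) ≤
      ∑ k ∈ S, (entropy (X k ⊓ Y C) - entropy (Y C)) := by
    refine le_trans (sub_le_sub_right (entropy_anti ?_) _) (entropy_iInf_inf_le X (Y C) S)
    refine le_inf (le_iInf fun i => ?_) inf_le_right
    by_cases hi : i ∈ S
    · exact inf_le_left.trans (iInf₂_le i hi)
    · exact inf_le_right.trans ((agreeOn_knownBy_le (by simpa using hi)).trans (hX i))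
  have hb : ∀ k ∈ S, Real.log (Fintype.card γ) * (#(W k) * #{n | mappers M n ⊆ S.erase k} : ℝ) +
        (entropy (Xa ⊓ Y (knownBy M W (S.erase k)ᶜ)) - entropy (Y (knownBy M W (S.erase k)ᶜ))) ≤
      entropy (Xa ⊓ Y C) - entropy (X k ⊓ Y C) := by
    intro k hk
    set D := C ∪ univ ×ˢ M k with hD
    have hE : knownBy M W (S.erase k)ᶜ = D ∪ W k ×ˢ univ := by
      rw [Finset.compl_erase, knownBy, Finset.biUnion_insert, hD, hC, knownBy]
      ac_rfl
    rw [hE]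
    have hYD : Y D = Y C ⊓ Y (univ ×ˢ M k) := agreeOn_union _ _
    have hYE : Y (D ∪ W k ×ˢ univ) = Y D ⊓ Y (W k ×ˢ univ) := agreeOn_union _ _
    have h1 : entropy (Xa ⊓ Y D) + entropy (X k ⊓ Y C) ≤ entropy (Xa ⊓ Y C) + entropy (Y D) := by
      have h := entropy_submodular (r := Xa ⊓ Y C) (s := Y D) (t := X k ⊓ Y C)
        (inf_le_inf_right _ (iInf_le _ _))
        (hYD ▸ le_inf (inf_le_right.trans (hX k)) inf_le_left)
      have h' : entropy (Xa ⊓ Y D) ≤ entropy (Xa ⊓ Y C ⊓ Y D) :=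
        entropy_anti (inf_le_inf_right _ inf_le_left)
      linarith
    have h2 : entropy (Xa ⊓ Y (D ∪ W k ×ˢ univ)) ≤ entropy (Xa ⊓ Y D) := by
      refine entropy_anti (le_inf inf_le_left ?_)
      rw [hYE]
      refine le_inf inf_le_right (le_trans ?_ (hdec k))
      exact le_inf inf_le_left (inf_le_right.trans (hYD ▸ inf_le_right))
    have h3 : (#D : ℝ) + #(W k) * #{n | mappers M n ⊆ S.erase k} ≤ #(D ∪ W k ×ˢ univ) := by
      exact_mod_cast card_knownBy_erase_ge M W hW hk
    have h4 := mul_le_mul_of_nonneg_right h3 hlog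
    simp only [hY, entropy_agreeOn] at h1 h2 ⊢
    linarith
  have hsum := Finset.sum_le_sum hb
  rw [Finset.sum_sub_distrib, Finset.sum_const, nsmul_eq_mul] at ha hsum
  linarith

/-- Among the nodes of `S`, with everything concerning the other nodes revealed, the messages carry
at least the sum of the contributions of the files mapped only inside `S`. -/
theorem converse_subset [Fintype γ] [Nonempty γ]
    (X : ι → Setoid (β × ν → γ)) (M : ι → Finset ν) (W : ι → Finset β)
    (hW : ∀ i j, i ≠ j → Disjoint (W i) (W j)) (hcov : ∀ n, ∃ i, n ∈ M i)
    (hX : ∀ i, agreeOn (univ ×ˢ M i) ≤ X i)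
    (hdec : ∀ i, (⨅ i, X i) ⊓ agreeOn (univ ×ˢ M i) ≤ agreeOn (W i ×ˢ univ)) (S : Finset ι) :
    Real.log (Fintype.card γ) * ∑ n, (if mappers M n ⊆ S then
        (∑ k ∈ S \ mappers M n, (#(W k) : ℝ)) / #(mappers M n) else 0) ≤
      entropy ((⨅ i, X i) ⊓ agreeOn (knownBy M W Sᶜ)) -
        entropy (agreeOn (knownBy M W Sᶜ) : Setoid (β × ν → γ)) := by
  have hne : ∀ n, (mappers M n).Nonempty := fun n => (hcov n).imp fun i hi => mem_mappers.2 hi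
  induction S using Finset.strongInduction with
  | H S ih =>
    by_cases hS : #S ≤ 1
    · have h0 : ∀ n, (if mappers M n ⊆ S then
          (∑ k ∈ S \ mappers M n, (#(W k) : ℝ)) / #(mappers M n) else 0) = 0 := by
        intro n
        split_ifs with h
        · have : mappers M n = S :=
            Finset.eq_of_subset_of_card_le h (hS.trans (hne n).card_pos)
          simp [this]
        · rfl
      simp only [h0, Finset.sum_const_zero, mul_zero, sub_nonneg]
      exact entropy_anti inf_le_right
    · push Not at hS
      have hS' : (0 : ℝ) < #S - 1 := by
        rw [sub_pos]
        exact_mod_cast hS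
      refine le_of_mul_le_mul_left ?_ hS'
      refine le_trans ?_ (converse_step X M W hW hX hdec S)
      refine le_trans (le_of_eq ?_) (Finset.sum_le_sum fun k hk =>
        add_le_add_right (ih (S.erase k) (Finset.erase_ssubset hk)) _)
      rw [mul_left_comm, Finset.mul_sum]
      simp_rw [← converse_recursion S _ (fun k => (#(W k) : ℝ)) (hne _), ← mul_add]
      rw [← Finset.mul_sum, Finset.sum_comm]
      congr 1
      refine Finset.sum_congr rfl fun k _ => ?_
      rw [Finset.card_filter, Nat.cast_sum, Finset.mul_sum, ← Finset.sum_add_distrib]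
      refine Finset.sum_congr rfl fun n _ => ?_
      split_ifs <;> simp

/-- The messages determine a variable of entropy at least the sum of the contributions of all
files. -/
theorem converse_le_entropy [Fintype γ] [Nonempty γ]
    (X : ι → Setoid (β × ν → γ)) (M : ι → Finset ν) (W : ι → Finset β)
    (hW : ∀ i j, i ≠ j → Disjoint (W i) (W j)) (hcov : ∀ n, ∃ i, n ∈ M i)
    (hX : ∀ i, agreeOn (univ ×ˢ M i) ≤ X i)
    (hdec : ∀ i, (⨅ i, X i) ⊓ agreeOn (univ ×ˢ M i) ≤ agreeOn (W i ×ˢ univ)) :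
    Real.log (Fintype.card γ) * ∑ n, (∑ k ∈ (mappers M n)ᶜ, (#(W k) : ℝ)) / #(mappers M n) ≤
      entropy (⨅ i, X i) := by
  have h := converse_subset X M W hW hcov hX hdec univ
  simpa [knownBy, agreeOn_empty, entropy_top, ← Finset.compl_eq_univ_sdiff] using h

end Converse

/-! ### The converse for schemes -/

section WeaklySymmetric

variable {K Q : ℕ} {S : Finset (Fin K)} {W : Fin K → Finset (Fin Q)}

lemma IsWeaklySymmetric.eq_empty (h : IsWeaklySymmetric 1 S W) {k : Fin K} (hk : k ∉ S) :
    W k = ∅ := by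
  obtain ⟨D, -, -, -, hW⟩ := h
  rw [hW, Finset.filter_eq_empty_iff.2, Finset.biUnion_empty]
  intro P hP hkP
  exact hk ((Finset.mem_powersetCard.1 hP).1 hkP)

lemma IsWeaklySymmetric.exists_batches (h : IsWeaklySymmetric 1 S W) :
    ∃ D : Finset (Fin K) → Finset (Fin Q), (∀ k ∈ S, W k = D {k}) ∧
      (∀ k ∈ S, #(D {k}) * #S = Q) ∧
      (∀ k ∈ S, ∀ l ∈ S, k ≠ l → Disjoint (D {k}) (D {l})) ∧ (0 < Q → S.Nonempty) := by
  obtain ⟨D, hcard, hdisj, hU, hW⟩ := h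
  have hmem : ∀ k ∈ S, ({k} : Finset (Fin K)) ∈ S.powersetCard 1 := fun k hk =>
    Finset.mem_powersetCard.2 ⟨by simpa using hk, by simp⟩
  refine ⟨D, fun k hk => ?_, fun k hk => ?_, fun k hk l hl hkl => ?_, fun hQ => ?_⟩
  · have : ((S.powersetCard 1).filter fun P => k ∈ P) = {{k}} := by
      ext P
      simp only [mem_filter, mem_powersetCard, mem_singleton]
      constructor
      · rintro ⟨⟨-, h1⟩, hkP⟩
        obtain ⟨a, rfl⟩ := Finset.card_eq_one.1 h1
        rw [Finset.mem_singleton.1 hkP]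
      · rintro rfl
        simpa using hk
    rw [hW, this, Finset.singleton_biUnion]
  · simpa using hcard _ (hmem k hk)
  · exact hdisj _ (hmem k hk) _ (hmem l hl) (by simpa using hkl)
  · have h0 : (⟨0, hQ⟩ : Fin Q) ∈ (S.powersetCard 1).biUnion D := hU ▸ Finset.mem_univ _
    obtain ⟨P, hP, -⟩ := Finset.mem_biUnion.1 h0
    obtain ⟨h1, h2⟩ := Finset.mem_powersetCard.1 hP
    exact (Finset.card_pos.1 (by omega : 0 < #P)).mono h1

lemma IsWeaklySymmetric.card_mul (h : IsWeaklySymmetric 1 S W) {k : Fin K} (hk : k ∈ S) :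
    #(W k) * #S = Q := by
  obtain ⟨D, hD, hc, -, -⟩ := h.exists_batches
  rw [hD k hk, hc k hk]

lemma IsWeaklySymmetric.disjoint (h : IsWeaklySymmetric 1 S W) {k l : Fin K} (hkl : k ≠ l) :
    Disjoint (W k) (W l) := by
  by_cases hk : k ∈ S
  · by_cases hl : l ∈ S
    · obtain ⟨D, hD, -, hd, -⟩ := h.exists_batches
      rw [hD k hk, hD l hl]
      exact hd k hk l hl hkl
    · rw [h.eq_empty hl]
      exact Finset.disjoint_empty_right _
  · rw [h.eq_empty hk]
    exact Finset.disjoint_empty_left _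

lemma IsWeaklySymmetric.nonempty (h : IsWeaklySymmetric 1 S W) (hQ : 0 < Q) : S.Nonempty := by
  obtain ⟨D, -, -, -, hne⟩ := h.exists_batches
  exact hne hQ

end WeaklySymmetric

/-- The task whose intermediate values are arbitrary blocks of the file contents and whose outputs
reveal all the intermediate values they depend on. -/
def universalTask (N Q V : ℕ) : Task N Q V where
  F := Q * V
  B := N * V
  g q _ ω := fun b => ω (finProdFinEquiv (q, b))
  h _ x := fun i => x (finProdFinEquiv.symm i).1 (finProdFinEquiv.symm i).2

/-- File contents giving the intermediate values `v` in the universal task. -/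
def universalFiles {N Q V : ℕ} (v : Fin Q × Fin N → Bits V) :
    Fin N → Bits (universalTask N Q V).F :=
  fun n i => v ((finProdFinEquiv.symm i).1, n) (finProdFinEquiv.symm i).2

lemma interm_universalFiles {N Q V : ℕ} (v : Fin Q × Fin N → Bits V) (q : Fin Q) (n : Fin N) :
    (universalTask N Q V).interm (universalFiles v) q n = v (q, n) := by
  funext b
  change universalFiles v n (finProdFinEquiv (q, b)) = _
  simp [universalFiles]

namespace Scheme

variable {K N M Q V s : ℕ} (σ : Scheme K N M Q V s)

/-- The message of node `k` as a function of all intermediate values. -/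
def message (k : Fin K) (v : Fin Q × Fin N → Bits V) : Bits (σ.len k) :=
  σ.encode k fun q n => v (q, n)

lemma message_congr {k : Fin K} {v v' : Fin Q × Fin N → Bits V}
    (h : agreeOn (univ ×ˢ σ.files k) v v') : σ.message k v = σ.message k v' := by
  unfold message
  congr 1
  funext q n
  exact h (q, n) (by simp)

/-- Decodability in information-theoretic form. -/
lemma agreeOn_reduce {k : Fin K} {v v' : Fin Q × Fin N → Bits V}
    (hm : ∀ i, σ.message i v = σ.message i v') (h : agreeOn (univ ×ˢ σ.files k) v v') :
    agreeOn (σ.reduce k ×ˢ univ) v v' := by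
  rintro ⟨q, n⟩ hq
  replace hq : q ∈ σ.reduce k := (Finset.mem_product.1 hq).1
  obtain ⟨dec, hdec⟩ := σ.correct (universalTask N Q V) k q hq
  have h1 := hdec (universalFiles v)
  have h2 := hdec (universalFiles v')
  simp only [interm_universalFiles] at h1 h2
  have e1 : (fun (q' : Fin Q) (n : {n // n ∈ σ.files k}) => v (q', (n : Fin N))) =
      fun (q' : Fin Q) (n : {n // n ∈ σ.files k}) => v' (q', (n : Fin N)) := by
    funext q' n
    exact h (q', n) (by simp)
  have e2 : (fun i => σ.encode i fun q' n => v (q', (n : Fin N))) =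
      fun i => σ.encode i fun q' n => v' (q', n) := funext hm
  rw [e1, e2, h2] at h1
  funext b
  have h3 := congrFun h1 (finProdFinEquiv (n, b))
  simp only [Task.output] at h3
  change (universalTask N Q V).interm (universalFiles v') q
    (finProdFinEquiv.symm (finProdFinEquiv (n, b))).1
    (finProdFinEquiv.symm (finProdFinEquiv (n, b))).2 =
    (universalTask N Q V).interm (universalFiles v) q
    (finProdFinEquiv.symm (finProdFinEquiv (n, b))).1
    (finProdFinEquiv.symm (finProdFinEquiv (n, b))).2 at h3
  rw [Equiv.symm_apply_apply, interm_universalFiles, interm_universalFiles] at h3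
  exact h3.symm

/-- The number of solvers that map file `n`. -/
def solverCount (n : Fin N) : ℕ := #{k ∈ σ.solvers | n ∈ σ.files k}

/-- `1` if some node that is not a solver maps file `n`, and `0` otherwise. -/
def helperCount (n : Fin N) : ℕ := if ∃ k, k ∉ σ.solvers ∧ n ∈ σ.files k then 1 else 0

/-- The files mapped after all the nodes other than the solvers are merged into one node `none`. -/
def mergedFiles : Option (Fin K) → Finset (Fin N)
  | some k => if k ∈ σ.solvers then σ.files k else ∅
  | none => {n | ∃ k, k ∉ σ.solvers ∧ n ∈ σ.files k}

/-- The Reduce functions of the merged nodes. -/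
def mergedReduce : Option (Fin K) → Finset (Fin Q)
  | some k => σ.reduce k
  | none => ∅

/-- The messages of the merged nodes, as equivalence relations. -/
def mergedMessages : Option (Fin K) → Setoid (Fin Q × Fin N → Bits V)
  | some k => if k ∈ σ.solvers then Setoid.ker (σ.message k) else ⊤
  | none => ⨅ k ∉ σ.solvers, Setoid.ker (σ.message k)

lemma mem_mergedFiles_some {k : Fin K} {n : Fin N} :
    n ∈ σ.mergedFiles (some k) ↔ k ∈ σ.solvers ∧ n ∈ σ.files k := by
  by_cases h : k ∈ σ.solvers <;> simp [mergedFiles, h]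

lemma iInf_mergedMessages : ⨅ i, σ.mergedMessages i = ⨅ k, Setoid.ker (σ.message k) := by
  rw [iInf_option]
  apply le_antisymm
  · refine le_iInf fun k => ?_
    by_cases hk : k ∈ σ.solvers
    · refine inf_le_right.trans ((iInf_le _ k).trans ?_)
      simp [mergedMessages, hk]
    · exact inf_le_left.trans (iInf₂_le k hk)
  · refine le_inf (le_iInf₂ fun k _ => iInf_le _ k) (le_iInf fun k => ?_)
    by_cases hk : k ∈ σ.solvers
    · refine (iInf_le _ k).trans ?_
      simp [mergedMessages, hk]
    · simp [mergedMessages, hk]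

lemma card_mappers_mergedFiles (n : Fin N) :
    #(mappers σ.mergedFiles n) = σ.solverCount n + σ.helperCount n := by
  have h : mappers σ.mergedFiles n = (({k ∈ σ.solvers | n ∈ σ.files k}).map .some) ∪
      (if ∃ k, k ∉ σ.solvers ∧ n ∈ σ.files k then {none} else ∅) := by
    ext i
    rw [mem_mappers]
    cases i with
    | none =>
      by_cases h : ∃ k, k ∉ σ.solvers ∧ n ∈ σ.files k <;> simp [mergedFiles, h]
    | some k =>
      rw [mem_mergedFiles_some]
      split_ifs <;> simp
  rw [h, Finset.card_union_of_disjoint, Finset.card_map, solverCount, helperCount]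
  · congr 1
    split_ifs <;> simp
  · split_ifs <;> simp

end Scheme

lemma entropy_iInf_ker_message_le {K N M Q V s : ℕ} (σ : Scheme K N M Q V s) :
    entropy (⨅ k, Setoid.ker (σ.message k)) ≤ (∑ k, σ.len k : ℕ) * Real.log 2 := by
  refine (entropy_anti (r := Setoid.ker fun v k => σ.message k v) ?_).trans
    ((entropy_ker_le_log_card _).trans (le_of_eq ?_))
  · exact le_iInf fun k v v' h => congrFun h k
  · simp [Fintype.card_pi, Finset.prod_pow_eq_pow_sum]

/-- The total length of the messages is at least the sum over the files of the demand of the solvers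
not mapping the file, divided by the number of nodes mapping it, where all nodes that are not
solvers count as one. -/
theorem Scheme.sum_len_ge {K N M Q V : ℕ} (σ : Scheme K N M Q V 1) :
    (V : ℝ) * ∑ n, ((#σ.solvers : ℝ) - σ.solverCount n) * ((Q : ℝ) / #σ.solvers) /
      (σ.solverCount n + σ.helperCount n) ≤ (∑ k, σ.len k : ℕ) := by
  have hlog : 0 < Real.log 2 := Real.log_pos (by norm_num)
  have hsym := σ.reduce_symmetric
  have h := converse_le_entropy σ.mergedMessages σ.mergedFiles σ.mergedReduce ?_ ?_ ?_ ?_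
  · rw [σ.iInf_mergedMessages] at h
    replace h := h.trans (entropy_iInf_ker_message_le σ)
    have e : Real.log (Fintype.card (Bits V)) = V * Real.log 2 := by simp
    rw [e, mul_right_comm] at h
    refine le_trans (le_of_eq ?_) (le_of_mul_le_mul_right h hlog)
    congr 1
    refine Finset.sum_congr rfl fun n _ => ?_
    rw [σ.card_mappers_mergedFiles]
    push_cast
    congr 1
    have h1 : ∑ k ∈ (mappers σ.mergedFiles n)ᶜ, (#(σ.mergedReduce k) : ℝ) =
        ∑ k ∈ σ.solvers with n ∉ σ.files k, (#(σ.reduce k) : ℝ) := by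
      refine Eq.trans (Eq.symm ?_) (Finset.sum_map (σ.solvers.filter fun k => n ∉ σ.files k)
        Function.Embedding.some fun i => (#(σ.mergedReduce i) : ℝ))
      refine Finset.sum_subset ?_ ?_
      · intro i hi
        obtain ⟨k, hk, rfl⟩ := Finset.mem_map.1 hi
        rw [Finset.mem_compl, mem_mappers]
        change n ∉ σ.mergedFiles (some k)
        rw [mem_mergedFiles_some]
        exact fun h => (Finset.mem_filter.1 hk).2 h.2
      · intro i hi hi'
        cases i with
        | none => simp [mergedReduce]
        | some k =>
          by_cases hk : k ∈ σ.solvers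
          · exfalso
            refine hi' (Finset.mem_map_of_mem Function.Embedding.some
              (Finset.mem_filter.2 ⟨hk, ?_⟩))
            rw [Finset.mem_compl, mem_mappers, mem_mergedFiles_some] at hi
            exact fun h => hi ⟨hk, h⟩
          · simp [mergedReduce, hsym.eq_empty hk]
    have h2 : ∀ k ∈ σ.solvers.filter fun k => n ∉ σ.files k,
        (#(σ.reduce k) : ℝ) = (Q : ℝ) / #σ.solvers := by
      intro k hk
      have hk' := (Finset.mem_filter.1 hk).1
      have hpos : (#σ.solvers : ℝ) ≠ 0 := by
        exact_mod_cast (Finset.card_pos.2 ⟨k, hk'⟩).ne'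
      rw [eq_div_iff hpos]
      exact_mod_cast hsym.card_mul hk'
    rw [h1, Finset.sum_congr rfl h2, Finset.sum_const, nsmul_eq_mul]
    congr 1
    have h3 := Finset.card_filter_add_card_filter_not (s := σ.solvers) (fun k => n ∈ σ.files k)
    rw [solverCount, ← h3]
    push_cast
    ring
  · rintro (_ | i) (_ | j) hij
    · exact absurd rfl hij
    · exact Finset.disjoint_empty_left _
    · exact Finset.disjoint_empty_right _
    · exact hsym.disjoint fun e => hij (e ▸ rfl)
  · intro n
    obtain ⟨k, hk⟩ := σ.files_cover n
    by_cases hks : k ∈ σ.solvers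
    · exact ⟨some k, σ.mem_mergedFiles_some.2 ⟨hks, hk⟩⟩
    · exact ⟨none, by simpa [mergedFiles] using ⟨k, hks, hk⟩⟩
  · rintro (_ | k)
    · refine le_iInf₂ fun k hk v v' h => σ.message_congr (agreeOn_anti ?_ h)
      refine Finset.product_subset_product_right fun n hn => ?_
      simpa [mergedFiles] using ⟨k, hk, hn⟩
    · by_cases hk : k ∈ σ.solvers
      · simp only [mergedMessages, mergedFiles, hk, if_true]
        exact fun v v' h => σ.message_congr h
      · simp [mergedMessages, hk]
  · rintro (_ | k)
    · simp [mergedReduce, agreeOn_empty]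
    · by_cases hk : k ∈ σ.solvers
      · rw [σ.iInf_mergedMessages]
        simp only [mergedReduce, mergedFiles, hk, if_true]
        intro v v' h
        refine σ.agreeOn_reduce (fun i => ?_) h.2
        exact (iInf_le (fun k => Setoid.ker (σ.message k)) i) h.1
      · simp [mergedReduce, hsym.eq_empty hk, agreeOn_empty]

/-! ### Rational minimisers -/

section RationalMin

open Filter Topology

/-- A `ℚ`-linear functional killing `1` detects irrationality. -/
lemma exists_ratLinear_ne_zero {x : ℝ} (hx : ∀ q : ℚ, x ≠ q) :
    ∃ φ : ℝ →ₗ[ℚ] ℝ, φ 1 = 0 ∧ φ x ≠ 0 := by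
  have hmem : x ∉ Submodule.span ℚ {(1 : ℝ)} := by
    intro h
    obtain ⟨q, hq⟩ := Submodule.mem_span_singleton.1 h
    exact hx q (by rw [← hq, Rat.smul_one_eq_cast])
  obtain ⟨f, hf, hker⟩ := Submodule.exists_le_ker_of_notMem hmem
  refine ⟨(Algebra.linearMap ℚ ℝ).comp f, ?_, ?_⟩
  · have : f 1 = 0 := hker (Submodule.mem_span_singleton_self 1)
    simp [this]
  · simpa using hf

/-- A linear inequality stays true for small perturbations along a `ℚ`-linear functional. -/
lemma eventually_le_perturb {u v : ℝ} (h : u ≤ v) (φ : ℝ →ₗ[ℚ] ℝ) :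
    ∀ᶠ ε : ℝ in 𝓝 0, u + ε * φ u ≤ v + ε * φ v := by
  rcases h.eq_or_lt with rfl | h
  · simp
  · have h1 : Tendsto (fun ε : ℝ => u + ε * φ u) (𝓝 0) (𝓝 (u + 0 * φ u)) :=
      (Continuous.tendsto (by fun_prop) 0)
    have h2 : Tendsto (fun ε : ℝ => v + ε * φ v) (𝓝 0) (𝓝 (v + 0 * φ v)) :=
      (Continuous.tendsto (by fun_prop) 0)
    filter_upwards [h1.eventually_lt h2 (by simpa using h)] with ε hε using hε.le

/-- The maximum of two quantities is affine for small perturbations along a `ℚ`-linear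
functional. -/
lemma eventually_max_perturb (u v : ℝ) (φ : ℝ →ₗ[ℚ] ℝ) :
    ∃ D : ℝ, ∀ᶠ ε : ℝ in 𝓝 0, max (u + ε * φ u) (v + ε * φ v) = max u v + ε * D := by
  rcases le_total u v with h | h
  · exact ⟨φ v, (eventually_le_perturb h φ).mono fun ε hε => by
      rw [max_eq_right hε, max_eq_right h]⟩
  · exact ⟨φ u, (eventually_le_perturb h φ).mono fun ε hε => by
      rw [max_eq_left hε, max_eq_left h]⟩

/-- A function on a compact set attains its minimum at a rational point, provided that moving a
point `x` a little along `φ ∘ x`, for `ℚ`-linear `φ` with `φ 1 = 0`, keeps it in the set and changes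
the function affinely. This is so for polyhedra and piecewise linear functions with rational
breaking conditions: those conditions that are tight at `x` are preserved, as `φ` commutes with
rational linear combinations and kills rational constants. An extreme point of the set of minimisers
admits no such movement, so it is rational. -/
theorem exists_rational_minimiser {ι : Type*} [Finite ι] {P : Set (ι → ℝ)} {f : (ι → ℝ) → ℝ}
    (hP : IsCompact P) (hne : P.Nonempty) (hf : Continuous f)
    (h : ∀ x ∈ P, ∀ φ : ℝ →ₗ[ℚ] ℝ, φ 1 = 0 → ∃ D : ℝ, ∀ᶠ ε : ℝ in 𝓝 0,
      (x + ε • fun i => φ (x i)) ∈ P ∧ f (x + ε • fun i => φ (x i)) = f x + ε * D) :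
    ∃ x ∈ P, (∀ y ∈ P, f x ≤ f y) ∧ ∀ i, ∃ q : ℚ, x i = q := by
  obtain ⟨x₀, hx₀, hmin₀⟩ := hP.exists_isMinOn hne hf.continuousOn
  have hS : IsCompact (P ∩ f ⁻¹' Set.Iic (f x₀)) :=
    hP.inter_right (isClosed_Iic.preimage hf)
  obtain ⟨x, hx⟩ := hS.extremePoints_nonempty ⟨x₀, hx₀, show f x₀ ≤ f x₀ from le_rfl⟩
  have hxP := hx.1.1
  have hxmin : ∀ y ∈ P, f x ≤ f y := fun y hy => le_trans hx.1.2 (hmin₀ hy)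
  refine ⟨x, hxP, hxmin, fun i => ?_⟩
  by_contra hirr
  push Not at hirr
  obtain ⟨φ, h1, hφ⟩ := exists_ratLinear_ne_zero hirr
  obtain ⟨D, hD⟩ := h x hxP φ h1
  obtain ⟨δ, hδ, hball⟩ := Metric.eventually_nhds_iff.1 hD
  have hp := hball (y := δ / 2) (by rw [Real.dist_eq, sub_zero, abs_of_pos] <;> linarith)
  have hm := hball (y := -(δ / 2)) (by
    rw [Real.dist_eq, sub_zero, abs_neg, abs_of_pos] <;> linarith)
  have hp1 := hxmin _ hp.1
  have hm1 := hxmin _ hm.1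
  have hD0 : δ / 2 * D = 0 := by
    rw [hp.2] at hp1
    rw [hm.2] at hm1
    linarith
  have hfx : f x ≤ f x₀ := hx.1.2
  have hseg : x ∈ openSegment ℝ (x + (δ / 2) • fun i => φ (x i))
      (x + (-(δ / 2)) • fun i => φ (x i)) := by
    refine ⟨1 / 2, 1 / 2, by norm_num, by norm_num, by norm_num, ?_⟩
    ext j
    simp
    ring
  have heq := (mem_extremePoints.1 hx).2 _ ⟨hp.1, by
    rw [Set.mem_preimage, Set.mem_Iic, hp.2]; linarith⟩ _ ⟨hm.1, by
    rw [Set.mem_preimage, Set.mem_Iic, hm.2]; linarith⟩ hseg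
  have := congrFun heq.1 i
  simp only [Pi.add_apply, Pi.smul_apply, smul_eq_mul, add_eq_left, mul_eq_zero] at this
  rcases this with h | h
  · linarith
  · exact hφ h

end RationalMin

/-! ### Lower convex envelopes -/

section Envelope

lemma lowerConvexEnvelope_le {P : Set (ℝ × ℝ)} (hP : ∀ p ∈ P, 0 ≤ p.2) {x y : ℝ}
    (h : (x, y) ∈ convexHull ℝ P) : lowerConvexEnvelope P x ≤ y := by
  refine csInf_le ⟨0, ?_⟩ h
  intro z hz
  have : convexHull ℝ P ⊆ {p : ℝ × ℝ | 0 ≤ p.2} :=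
    convexHull_min hP (convex_halfSpace_ge (𝕜 := ℝ) (LinearMap.snd ℝ ℝ ℝ).isLinear 0)
  exact this hz

/-- Over the range of abscissas the envelope of a finite set is attained. -/
lemma lowerConvexEnvelope_mem {P : Set (ℝ × ℝ)} (hP : P.Finite) {x : ℝ}
    (h : ∃ y, (x, y) ∈ convexHull ℝ P) : (x, lowerConvexEnvelope P x) ∈ convexHull ℝ P := by
  have hc : IsCompact (convexHull ℝ P) := hP.isCompact_convexHull (𝕜 := ℝ)
  have hK : IsCompact {y | (x, y) ∈ convexHull ℝ P} := by
    have : {y | (x, y) ∈ convexHull ℝ P} = Prod.snd '' (convexHull ℝ P ∩ Prod.fst ⁻¹' {x}) := by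
      ext y
      constructor
      · exact fun hy => ⟨(x, y), ⟨hy, rfl⟩, rfl⟩
      · rintro ⟨⟨a, b⟩, ⟨hab, rfl⟩, rfl⟩
        exact hab
    rw [this]
    exact (hc.inter_right (isClosed_singleton.preimage continuous_fst)).image continuous_snd
  exact hK.sInf_mem h

/-- At the abscissa of a point of `P` on the graph of a convex function below `P`, the envelope is
the ordinate of the point. -/
lemma lowerConvexEnvelope_eq {P : Set (ℝ × ℝ)} {s : Set ℝ} {f : ℝ → ℝ} (hf : ConvexOn ℝ s f)
    (hP : ∀ p ∈ P, p.1 ∈ s ∧ p.2 = f p.1) {x : ℝ} (hx : (x, f x) ∈ P) :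
    lowerConvexEnvelope P x = f x := by
  have hsub : convexHull ℝ P ⊆ {p | p.1 ∈ s ∧ f p.1 ≤ p.2} :=
    convexHull_min (fun p hp => ⟨(hP p hp).1, (hP p hp).2.ge⟩) hf.convex_epigraph
  have hmem : (x, f x) ∈ convexHull ℝ P := subset_convexHull ℝ P hx
  refine le_antisymm (csInf_le ⟨f x, fun y hy => (hsub hy).2⟩ hmem) ?_
  exact le_csInf ⟨f x, hmem⟩ fun y hy => (hsub hy).2

/-- Points of the convex hull of a finite family of points with distinct abscissas, as weighted
means. -/
lemma mem_convexHull_image_iff {ι : Type*} (I : Finset ι) (g f : ι → ℝ) (hg : Set.InjOn g I)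
    (x y : ℝ) : (x, y) ∈ convexHull ℝ ((fun j => (g j, f j)) '' (I : Set ι)) ↔
      ∃ w : ι → ℝ, (∀ j ∈ I, 0 ≤ w j) ∧ ∑ j ∈ I, w j = 1 ∧ ∑ j ∈ I, w j * g j = x ∧
        ∑ j ∈ I, w j * f j = y := by
  classical
  constructor
  · intro h
    rw [← Finset.coe_image, Finset.mem_convexHull'] at h
    obtain ⟨w, hw0, hw1, hw⟩ := h
    have hinj : Set.InjOn (fun j => (g j, f j)) (I : Set ι) :=
      fun a ha b hb hab => hg ha hb (Prod.mk.inj hab).1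
    rw [Finset.sum_image hinj] at hw1 hw
    refine ⟨fun j => w (g j, f j), fun j hj => hw0 _ (Finset.mem_image_of_mem _ hj), hw1, ?_, ?_⟩
    · simpa [Prod.fst_sum] using congrArg Prod.fst hw
    · simpa [Prod.snd_sum] using congrArg Prod.snd hw
  · rintro ⟨w, hw0, hw1, rfl, rfl⟩
    have := Finset.centerMass_mem_convexHull I (R := ℝ) (w := w) hw0 (by rw [hw1]; norm_num)
      (z := fun j => (g j, f j)) (s := (fun j => (g j, f j)) '' (I : Set ι))
      fun j hj => Set.mem_image_of_mem _ hj
    rw [Finset.centerMass_eq_of_sum_1 _ _ hw1] at this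
    convert this using 1
    ext <;> simp [Prod.fst_sum, Prod.snd_sum]

lemma load1_eq {Ks : ℕ} {r : ℝ} (hr : r ≠ 0) : load1 Ks r = r⁻¹ - 1 / Ks := by
  unfold load1
  field_simp

lemma load2_eq {Ks : ℕ} {r : ℝ} (hr : r + 1 ≠ 0) :
    load2 Ks r = (1 + 1 / Ks) * (r + 1)⁻¹ - 1 / Ks := by
  unfold load2
  field_simp
  ring

lemma convexOn_load1 (Ks : ℕ) : ConvexOn ℝ (Set.Ioi 0) (load1 Ks) := by
  have h : ConvexOn ℝ (Set.Ioi 0) fun r : ℝ => r⁻¹ + -(1 / (Ks : ℝ)) := by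
    refine ConvexOn.add_const ?_ _
    simpa using convexOn_zpow (𝕜 := ℝ) (-1)
  refine h.congr fun r hr => ?_
  rw [load1_eq (ne_of_gt hr), sub_eq_add_neg]

lemma convexOn_load2 (Ks : ℕ) : ConvexOn ℝ (Set.Ioi (-1)) (load2 Ks) := by
  have h0 : ConvexOn ℝ (Set.Ioi 0) fun r : ℝ => r⁻¹ := by
    simpa using convexOn_zpow (𝕜 := ℝ) (-1)
  have h1 : ConvexOn ℝ (Set.Ioi (-1)) fun r : ℝ => (r + 1)⁻¹ := by
    have := h0.translate_left 1
    refine (this.subset ?_ (convex_Ioi _)).congr fun r _ => rfl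
    intro r hr
    simp only [Set.mem_Ioi, Set.mem_preimage] at hr ⊢
    linarith
  have h2 : ConvexOn ℝ (Set.Ioi (-1)) fun r : ℝ =>
      (1 + 1 / (Ks : ℝ)) • (r + 1)⁻¹ + -(1 / (Ks : ℝ)) :=
    (h1.smul (by positivity)).add_const _
  refine h2.congr fun r hr => ?_
  rw [load2_eq (by rw [Set.mem_Ioi] at hr; linarith), sub_eq_add_neg]
  rfl

lemma load1_points_eq (Ks : ℕ) :
    {p : ℝ × ℝ | ∃ r : ℕ, 1 ≤ r ∧ r ≤ Ks ∧ p = ((r : ℝ), load1 Ks r)} =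
      (fun j : Fin (Ks + 1) => (((j : ℕ) : ℝ), load1 Ks (j : ℕ))) ''
        (univ.erase 0 : Finset (Fin (Ks + 1))) := by
  ext p
  constructor
  · rintro ⟨r, h1, hr, rfl⟩
    refine ⟨⟨r, Nat.lt_succ_of_le hr⟩, ?_, rfl⟩
    refine Finset.mem_coe.2 (Finset.mem_erase.2 ⟨fun h => ?_, Finset.mem_univ _⟩)
    have : r = 0 := congrArg Fin.val h
    omega
  · rintro ⟨j, hj, rfl⟩
    refine ⟨j, Nat.one_le_iff_ne_zero.2 fun h => ?_, Nat.lt_succ_iff.1 j.2, rfl⟩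
    exact Finset.ne_of_mem_erase (Finset.mem_coe.1 hj) (Fin.ext h)

lemma load2_points_eq (Ks : ℕ) :
    {p : ℝ × ℝ | ∃ r : ℕ, r ≤ Ks ∧ p = ((r : ℝ), load2 Ks r)} =
      (fun j : Fin (Ks + 1) => (((j : ℕ) : ℝ), load2 Ks (j : ℕ))) ''
        (univ : Finset (Fin (Ks + 1))) := by
  ext p
  constructor
  · rintro ⟨r, hr, rfl⟩
    exact ⟨⟨r, Nat.lt_succ_of_le hr⟩, by simp, rfl⟩
  · rintro ⟨j, -, rfl⟩
    exact ⟨j, Nat.lt_succ_iff.1 j.2, rfl⟩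

lemma injective_fin_cast_real (n : ℕ) : Function.Injective fun j : Fin n => ((j : ℕ) : ℝ) :=
  Nat.cast_injective.comp Fin.val_injective

lemma load1_nonneg {Ks j : ℕ} (hj : j ≤ Ks) : 0 ≤ load1 Ks j := by
  refine mul_nonneg (by positivity) (sub_nonneg.2 (div_le_one_of_le₀ ?_ (by positivity)))
  exact_mod_cast hj

lemma load2_nonneg {Ks j : ℕ} (hj : j ≤ Ks) : 0 ≤ load2 Ks j := by
  refine mul_nonneg (by positivity) (sub_nonneg.2 (div_le_one_of_le₀ ?_ (by positivity)))
  exact_mod_cast hj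

lemma load1Env_natCast {Ks j : ℕ} (h1 : 1 ≤ j) (hj : j ≤ Ks) : load1Env Ks j = load1 Ks j := by
  refine lowerConvexEnvelope_eq (convexOn_load1 Ks) ?_ ⟨j, h1, hj, rfl⟩
  rintro p ⟨r, hr, -, rfl⟩
  exact ⟨show (0 : ℝ) < r by exact_mod_cast hr, rfl⟩

lemma load2Env_natCast {Ks j : ℕ} (hj : j ≤ Ks) : load2Env Ks j = load2 Ks j := by
  refine lowerConvexEnvelope_eq (convexOn_load2 Ks) ?_ ⟨j, hj, rfl⟩
  rintro p ⟨r, -, rfl⟩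
  exact ⟨by rw [Set.mem_Ioi]; linarith [Nat.cast_nonneg (α := ℝ) r], rfl⟩

lemma load1Env_le_mean {Ks : ℕ} {w : Fin (Ks + 1) → ℝ} (h0 : ∀ j, 0 ≤ w j) (hw : w 0 = 0)
    (h1 : ∑ j, w j = 1) :
    load1Env Ks (∑ j, w j * (j : ℕ)) ≤ ∑ j, w j * load1 Ks (j : ℕ) := by
  refine lowerConvexEnvelope_le ?_ ?_
  · rintro p ⟨r, -, hr, rfl⟩
    exact load1_nonneg hr
  · rw [load1_points_eq]
    refine (mem_convexHull_image_iff _ _ (fun j : Fin (Ks + 1) => load1 Ks (j : ℕ))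
      (injective_fin_cast_real _).injOn _ _).2 ⟨w, fun j _ => h0 j, ?_, ?_, ?_⟩
    · rw [← h1, Finset.sum_erase _ hw]
    · rw [Finset.sum_erase _ (by simp)]
    · rw [Finset.sum_erase _ (by simp [hw])]

lemma load2Env_le_mean {Ks : ℕ} {w : Fin (Ks + 1) → ℝ} (h0 : ∀ j, 0 ≤ w j) (h1 : ∑ j, w j = 1) :
    load2Env Ks (∑ j, w j * (j : ℕ)) ≤ ∑ j, w j * load2 Ks (j : ℕ) := by
  refine lowerConvexEnvelope_le ?_ ?_
  · rintro p ⟨r, hr, rfl⟩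
    exact load2_nonneg hr
  · rw [load2_points_eq]
    exact (mem_convexHull_image_iff _ _ (fun j : Fin (Ks + 1) => load2 Ks (j : ℕ))
      (injective_fin_cast_real _).injOn _ _).2 ⟨w, fun j _ => h0 j, h1, rfl, rfl⟩

/-- The convex hull of two points over `a` and `b` lies over the whole interval `[a, b]`. -/
lemma exists_mem_convexHull_graph (f : ℝ → ℝ) {a b : ℝ} {r : ℝ} (ha : a ≤ r)
    (hb : r ≤ b) {P : Set (ℝ × ℝ)} (hPa : (a, f a) ∈ P) (hPb : (b, f b) ∈ P) :
    ∃ y, (r, y) ∈ convexHull ℝ P := by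
  have hc : Convex ℝ (Prod.fst '' convexHull ℝ P) :=
    (convex_convexHull ℝ P).linear_image (LinearMap.fst ℝ ℝ ℝ)
  obtain ⟨p, hp, rfl⟩ := hc.ordConnected.out ⟨_, subset_convexHull ℝ P hPa, rfl⟩
    ⟨_, subset_convexHull ℝ P hPb, rfl⟩ ⟨ha, hb⟩
  exact ⟨p.2, hp⟩

lemma exists_mean_eq_load1Env {Ks : ℕ} {r : ℝ} (h1 : 1 ≤ r) (hr : r ≤ Ks) :
    ∃ w : Fin (Ks + 1) → ℝ, (∀ j, 0 ≤ w j) ∧ w 0 = 0 ∧ ∑ j, w j = 1 ∧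
      ∑ j, w j * (j : ℕ) = r ∧ ∑ j, w j * load1 Ks (j : ℕ) = load1Env Ks r := by
  have hKs : 1 ≤ Ks := by exact_mod_cast h1.trans hr
  have hmem : (r, load1Env Ks r) ∈ convexHull ℝ
      {p : ℝ × ℝ | ∃ r : ℕ, 1 ≤ r ∧ r ≤ Ks ∧ p = ((r : ℝ), load1 Ks r)} := by
    refine lowerConvexEnvelope_mem ?_ (exists_mem_convexHull_graph (load1 Ks) h1 hr
      ⟨1, le_rfl, hKs, by simp⟩ ⟨Ks, hKs, le_rfl, rfl⟩)
    rw [load1_points_eq]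
    exact (Finset.finite_toSet _).image _
  rw [load1_points_eq] at hmem
  obtain ⟨w, hw0, hw1, hwr, hwl⟩ := (mem_convexHull_image_iff _ _
    (fun j : Fin (Ks + 1) => load1 Ks (j : ℕ)) (injective_fin_cast_real _).injOn _ _).1 hmem
  have h0 : ∀ j ∈ univ.erase (0 : Fin (Ks + 1)), Function.update w 0 0 j = w j :=
    fun j hj => Function.update_of_ne (Finset.ne_of_mem_erase hj) _ _
  refine ⟨Function.update w 0 0, fun j => ?_, by simp, ?_, ?_, ?_⟩
  · by_cases hj : j = 0
    · simp [hj]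
    · rw [Function.update_of_ne hj]
      exact hw0 j (by simp [hj])
  · rw [← hw1, ← Finset.sum_erase _ (a := 0) (by simp)]
    exact Finset.sum_congr rfl h0
  · rw [← hwr, ← Finset.sum_erase _ (a := 0) (by simp)]
    exact Finset.sum_congr rfl fun j hj => by rw [h0 j hj]
  · rw [← hwl, ← Finset.sum_erase _ (a := 0) (by simp)]
    exact Finset.sum_congr rfl fun j hj => by rw [h0 j hj]

lemma exists_mean_eq_load2Env {Ks : ℕ} {r : ℝ} (h0 : 0 ≤ r) (hr : r ≤ Ks) :
    ∃ w : Fin (Ks + 1) → ℝ, (∀ j, 0 ≤ w j) ∧ ∑ j, w j = 1 ∧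
      ∑ j, w j * (j : ℕ) = r ∧ ∑ j, w j * load2 Ks (j : ℕ) = load2Env Ks r := by
  have hmem : (r, load2Env Ks r) ∈ convexHull ℝ
      {p : ℝ × ℝ | ∃ r : ℕ, r ≤ Ks ∧ p = ((r : ℝ), load2 Ks r)} := by
    refine lowerConvexEnvelope_mem ?_ (exists_mem_convexHull_graph (load2 Ks) h0 hr
      ⟨0, Nat.zero_le _, by simp⟩ ⟨Ks, le_rfl, rfl⟩)
    rw [load2_points_eq]
    exact (Finset.finite_toSet _).image _
  rw [load2_points_eq] at hmem
  obtain ⟨w, hw0, hw⟩ := (mem_convexHull_image_iff _ _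
    (fun j : Fin (Ks + 1) => load2 Ks (j : ℕ)) (injective_fin_cast_real _).injOn _ _).1 hmem
  exact ⟨w, fun j => hw0 j (Finset.mem_univ j), hw⟩

end Envelope

/-! ### Mixtures of file types -/

section Mixture

/-- A distribution of the files over types, for `Ks` solvers and `Kh` helpers: `a j` is the fraction
of files mapped by `j` solvers and no helper, and `b j` the fraction of files mapped by `j` solvers
and one helper. The storage available per file is `ρ`. -/
structure IsMixture (Ks Kh : ℕ) (ρ : ℝ) (a b : Fin (Ks + 1) → ℝ) : Prop where
  a_nonneg : ∀ j, 0 ≤ a j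
  b_nonneg : ∀ j, 0 ≤ b j
  a_zero : a 0 = 0
  sum_eq : ∑ j, a j + ∑ j, b j = 1
  storage : ∑ j, a j * (j : ℕ) + ∑ j, b j * ((j : ℕ) + 1) ≤ ρ
  no_helper : Kh = 0 → ∀ j, b j = 0

/-- The execution time of a mixture; unlike `Allocation.time` it involves no envelopes and, apart
from the maximum, is linear. -/
noncomputable def mixtureTime (Ks Kh Q : ℕ) (cm cs cr : ℝ) (a b : Fin (Ks + 1) → ℝ) : ℝ :=
  cm * max ((∑ j, a j * (j : ℕ) + ∑ j, b j * (j : ℕ)) / Ks) ((∑ j, b j) / Kh) + cr * ((Q : ℝ) / Ks)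
    + cs * (∑ j, a j * load1 Ks (j : ℕ) + ∑ j, b j * load2 Ks (j : ℕ))

lemma sum_mul_le_mul_sum {Ks : ℕ} {w : Fin (Ks + 1) → ℝ} (h0 : ∀ j, 0 ≤ w j) :
    ∑ j, w j * (j : ℕ) ≤ (∑ j, w j) * Ks := by
  rw [Finset.sum_mul]
  refine Finset.sum_le_sum fun j _ => mul_le_mul_of_nonneg_left ?_ (h0 j)
  exact_mod_cast Nat.lt_succ_iff.1 j.2

/-- Files without helpers may be replaced by their mean, with a load on the envelope. -/
lemma exists_mean_load1 {Ks : ℕ} (hKs : 1 ≤ Ks) {a : Fin (Ks + 1) → ℝ} (h0 : ∀ j, 0 ≤ a j)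
    (ha : a 0 = 0) : ∃ r : ℝ, 1 ≤ r ∧ r ≤ Ks ∧ (∑ j, a j) * r = ∑ j, a j * (j : ℕ) ∧
      (∑ j, a j) * load1Env Ks r ≤ ∑ j, a j * load1 Ks (j : ℕ) := by
  have hload : 0 ≤ ∑ j, a j * load1 Ks (j : ℕ) := Finset.sum_nonneg fun j _ =>
    mul_nonneg (h0 j) (load1_nonneg (Nat.lt_succ_iff.1 j.2))
  rcases (Finset.sum_nonneg fun j (_ : j ∈ univ) => h0 j).eq_or_lt with h | h
  · have hz : ∀ j, a j = 0 := fun j =>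
      (Finset.sum_eq_zero_iff_of_nonneg fun j _ => h0 j).1 h.symm j (Finset.mem_univ j)
    refine ⟨1, le_rfl, by exact_mod_cast hKs, ?_, ?_⟩
    · simp [hz]
    · rw [← h, zero_mul]
      exact hload
  · set α := ∑ j, a j with hα
    have hmean := load1Env_le_mean (Ks := Ks) (w := fun j => a j / α)
      (fun j => div_nonneg (h0 j) h.le) (by simp [ha])
      (by rw [← Finset.sum_div]; exact div_self h.ne')
    simp only [div_mul_eq_mul_div, ← Finset.sum_div] at hmean
    refine ⟨(∑ j, a j * (j : ℕ)) / α, ?_, ?_, mul_div_cancel₀ _ h.ne', ?_⟩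
    · rw [le_div_iff₀ h, one_mul, hα]
      refine Finset.sum_le_sum fun j _ => ?_
      by_cases hj : j = 0
      · simp [hj, ha]
      · have : (1 : ℝ) ≤ (j : ℕ) := by
          exact_mod_cast Nat.one_le_iff_ne_zero.2 fun e => hj (Fin.ext e)
        exact le_mul_of_one_le_right (h0 j) this
    · rw [div_le_iff₀ h, mul_comm]
      exact sum_mul_le_mul_sum h0
    · rwa [le_div_iff₀ h, mul_comm] at hmean

/-- Files with helpers may be replaced by their mean, with a load on the envelope. -/
lemma exists_mean_load2 {Ks : ℕ} {b : Fin (Ks + 1) → ℝ} (h0 : ∀ j, 0 ≤ b j) :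
    ∃ r : ℝ, 0 ≤ r ∧ r ≤ Ks ∧ (∑ j, b j) * r = ∑ j, b j * (j : ℕ) ∧
      (∑ j, b j) * load2Env Ks r ≤ ∑ j, b j * load2 Ks (j : ℕ) := by
  have hload : 0 ≤ ∑ j, b j * load2 Ks (j : ℕ) := Finset.sum_nonneg fun j _ =>
    mul_nonneg (h0 j) (load2_nonneg (Nat.lt_succ_iff.1 j.2))
  rcases (Finset.sum_nonneg fun j (_ : j ∈ univ) => h0 j).eq_or_lt with h | h
  · have hz : ∀ j, b j = 0 := fun j =>
      (Finset.sum_eq_zero_iff_of_nonneg fun j _ => h0 j).1 h.symm j (Finset.mem_univ j)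
    refine ⟨0, le_rfl, Nat.cast_nonneg _, ?_, ?_⟩
    · simp [hz]
    · rw [← h, zero_mul]
      exact hload
  · set β := ∑ j, b j with hβ
    have hmean := load2Env_le_mean (Ks := Ks) (w := fun j => b j / β)
      (fun j => div_nonneg (h0 j) h.le) (by rw [← Finset.sum_div]; exact div_self h.ne')
    simp only [div_mul_eq_mul_div, ← Finset.sum_div] at hmean
    refine ⟨(∑ j, b j * (j : ℕ)) / β, ?_, ?_, mul_div_cancel₀ _ h.ne', ?_⟩
    · exact div_nonneg (Finset.sum_nonneg fun j _ => mul_nonneg (h0 j) (Nat.cast_nonneg _)) h.le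
    · rw [div_le_iff₀ h, mul_comm]
      exact sum_mul_le_mul_sum h0
    · rwa [le_div_iff₀ h, mul_comm] at hmean

variable {K N M Q : ℕ} {cm cs cr : ℝ}

/-- The allocation of the mean redundancies of a mixture is at least as fast. -/
lemma IsMixture.exists_allocation {Ks Kh : ℕ} {a b : Fin (Ks + 1) → ℝ}
    (h : IsMixture Ks Kh ((M : ℝ) / N) a b) (hK : Ks + Kh ≤ K) (hKs : 1 ≤ Ks) (hdvd : Ks ∣ Q)
    (hQ : 1 ≤ Q) (hcs : 0 < cs) :
    ∃ A : Allocation, A.Feasible K N M Q ∧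
      A.time load1Env load2Env Q cm cs cr ≤ mixtureTime Ks Kh Q cm cs cr a b := by
  obtain ⟨r₁, h1, h2, h3, h4⟩ := exists_mean_load1 hKs h.a_nonneg h.a_zero
  obtain ⟨r₂, h5, h6, h7, h8⟩ := exists_mean_load2 h.b_nonneg
  have hb : 1 - ∑ j, a j = ∑ j, b j := by linarith [h.sum_eq]
  refine ⟨⟨∑ j, a j, r₁, r₂, Ks, Kh⟩, ⟨hK, hKs, Nat.le_of_dvd hQ hdvd, hdvd, ?_,
    Finset.sum_nonneg fun j _ => h.a_nonneg j, ?_, fun h0 => ?_, h1, h2, h5, h6⟩, ?_⟩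
  · have hst := h.storage
    simp only [mul_add, mul_one, Finset.sum_add_distrib] at hst
    simp only [hb]
    linarith
  · have := Finset.sum_nonneg fun j (_ : j ∈ univ) => h.b_nonneg j
    simp only
    linarith
  · have hz : ∑ j, b j = 0 := Finset.sum_eq_zero fun j _ => h.no_helper h0 j
    simp only
    linarith
  · simp only [Allocation.time, mixtureTime, hb, h3, h7]
    have := mul_le_mul_of_nonneg_left (add_le_add h4 h8) hcs.le
    linarith

/-- Every allocation is realised by a mixture. -/
lemma Allocation.Feasible.exists_mixture {A : Allocation} (h : A.Feasible K N M Q) :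
    ∃ a b, IsMixture A.Ks A.Kh ((M : ℝ) / N) a b ∧
      mixtureTime A.Ks A.Kh Q cm cs cr a b = A.time load1Env load2Env Q cm cs cr := by
  obtain ⟨w, hw0, hwz, hw1, hwr, hwl⟩ := exists_mean_eq_load1Env h.one_le_r₁ h.r₁_le
  obtain ⟨v, hv0, hv1, hvr, hvl⟩ := exists_mean_eq_load2Env h.r₂_nonneg h.r₂_le
  have hα : 0 ≤ 1 - A.α := by linarith [h.α_le_one]
  refine ⟨fun j => A.α * w j, fun j => (1 - A.α) * v j,
    ⟨fun j => mul_nonneg h.α_nonneg (hw0 j), fun j => mul_nonneg hα (hv0 j), by simp [hwz],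
      ?_, ?_, fun h0 j => by simp [h.no_helper h0]⟩, ?_⟩
  · simp only [← Finset.mul_sum, hw1, hv1]
    ring
  · have hs := h.storage
    simp only [mul_assoc, ← Finset.mul_sum, mul_add, mul_one, Finset.sum_add_distrib, hwr, hvr,
      hv1] at hs ⊢
    exact hs
  · simp only [Allocation.time, mixtureTime, mul_assoc, ← Finset.mul_sum, hwr, hvr, hwl, hvl, hv1]
    ring_nf

end Mixture

section Rational

open Filter Topology

lemma ratLinear_mul_natCast (φ : ℝ →ₗ[ℚ] ℝ) (x : ℝ) (n : ℕ) : φ (x * n) = φ x * n := by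
  rw [mul_comm, ← nsmul_eq_mul, map_nsmul, nsmul_eq_mul, mul_comm]

lemma ratLinear_div_natCast (φ : ℝ →ₗ[ℚ] ℝ) (x : ℝ) (n : ℕ) : φ (x / n) = φ x / n := by
  have h : ∀ y : ℝ, y / n = (n : ℚ)⁻¹ • y := fun y => by
    rw [Rat.smul_def]
    push_cast
    ring
  rw [h, h, map_smul]

lemma ratLinear_natCast {φ : ℝ →ₗ[ℚ] ℝ} (h : φ 1 = 0) (n : ℕ) : φ n = 0 := by
  have := ratLinear_mul_natCast φ 1 n
  simpa [h] using this

lemma sum_perturb {ι : Type*} [Fintype ι] (φ : ℝ →ₗ[ℚ] ℝ) (w : ι → ℝ) (ε : ℝ) :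
    ∑ j, (w j + ε * φ (w j)) = ∑ j, w j + ε * φ (∑ j, w j) := by
  rw [Finset.sum_add_distrib, ← Finset.mul_sum, map_sum]

lemma sum_perturb_mul {ι : Type*} [Fintype ι] (φ : ℝ →ₗ[ℚ] ℝ) (w : ι → ℝ) (n : ι → ℕ) (ε : ℝ) :
    ∑ j, (w j + ε * φ (w j)) * n j = ∑ j, w j * n j + ε * φ (∑ j, w j * n j) := by
  rw [map_sum, Finset.mul_sum, ← Finset.sum_add_distrib]
  refine Finset.sum_congr rfl fun j _ => ?_
  rw [ratLinear_mul_natCast]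
  ring

lemma IsMixture.eventually_perturb {Ks Kh N M : ℕ} {a b : Fin (Ks + 1) → ℝ}
    (h : IsMixture Ks Kh ((M : ℝ) / N) a b) {φ : ℝ →ₗ[ℚ] ℝ} (hφ : φ 1 = 0) :
    ∀ᶠ ε : ℝ in 𝓝 0, IsMixture Ks Kh ((M : ℝ) / N) (fun j => a j + ε * φ (a j))
      fun j => b j + ε * φ (b j) := by
  have ha : ∀ᶠ ε : ℝ in 𝓝 0, ∀ j, 0 + ε * φ 0 ≤ a j + ε * φ (a j) :=
    eventually_all.2 fun j => eventually_le_perturb (h.a_nonneg j) φ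
  have hb : ∀ᶠ ε : ℝ in 𝓝 0, ∀ j, 0 + ε * φ 0 ≤ b j + ε * φ (b j) :=
    eventually_all.2 fun j => eventually_le_perturb (h.b_nonneg j) φ
  filter_upwards [ha, hb, eventually_le_perturb h.storage φ] with ε h1 h2 h3
  simp only [map_zero, mul_zero, add_zero] at h1 h2
  refine ⟨h1, h2, by simp [h.a_zero], ?_, ?_, fun h0 j => by simp [h.no_helper h0 j]⟩
  · rw [sum_perturb, sum_perturb, add_add_add_comm, ← mul_add, ← map_add, h.sum_eq, hφ]
    simp
  · rw [ratLinear_div_natCast, ratLinear_natCast hφ, zero_div, mul_zero, add_zero] at h3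
    refine le_trans (le_of_eq ?_) h3
    have e := sum_perturb_mul φ b (fun j => (j : ℕ) + 1) ε
    push_cast at e
    rw [sum_perturb_mul, e, map_add]
    ring

lemma mixtureTime_eventually_perturb (Ks Kh Q : ℕ) (cm cs cr : ℝ) (a b : Fin (Ks + 1) → ℝ)
    (φ : ℝ →ₗ[ℚ] ℝ) : ∃ D : ℝ, ∀ᶠ ε : ℝ in 𝓝 0,
      mixtureTime Ks Kh Q cm cs cr (fun j => a j + ε * φ (a j)) (fun j => b j + ε * φ (b j)) =
        mixtureTime Ks Kh Q cm cs cr a b + ε * D := by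
  obtain ⟨D, hD⟩ := eventually_max_perturb
    ((∑ j, a j * (j : ℕ) + ∑ j, b j * (j : ℕ)) / Ks) ((∑ j, b j) / Kh) φ
  refine ⟨cm * D + cs * (∑ j, φ (a j) * load1 Ks (j : ℕ) + ∑ j, φ (b j) * load2 Ks (j : ℕ)), ?_⟩
  filter_upwards [hD] with ε hε
  have e1 : (∑ j, (a j + ε * φ (a j)) * (j : ℕ) + ∑ j, (b j + ε * φ (b j)) * (j : ℕ)) / (Ks : ℝ) =
      (∑ j, a j * (j : ℕ) + ∑ j, b j * (j : ℕ)) / Ks +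
        ε * φ ((∑ j, a j * (j : ℕ) + ∑ j, b j * (j : ℕ)) / Ks) := by
    rw [sum_perturb_mul, sum_perturb_mul, ratLinear_div_natCast, map_add]
    ring
  have e2 : (∑ j, (b j + ε * φ (b j))) / (Kh : ℝ) =
      (∑ j, b j) / Kh + ε * φ ((∑ j, b j) / Kh) := by
    rw [sum_perturb, ratLinear_div_natCast]
    ring
  unfold mixtureTime
  rw [e1, e2, hε]
  simp only [add_mul, Finset.sum_add_distrib, mul_assoc, ← Finset.mul_sum]
  ring

lemma isCompact_mixtures (Ks Kh : ℕ) (ρ : ℝ) :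
    IsCompact {x : Fin (Ks + 1) ⊕ Fin (Ks + 1) → ℝ |
      IsMixture Ks Kh ρ (fun j => x (.inl j)) fun j => x (.inr j)} := by
  refine (isCompact_Icc (a := 0) (b := 1)).of_isClosed_subset ?_ ?_
  · have : {x : Fin (Ks + 1) ⊕ Fin (Ks + 1) → ℝ |
        IsMixture Ks Kh ρ (fun j => x (.inl j)) fun j => x (.inr j)} =
        {x | ∀ j, 0 ≤ x (.inl j)} ∩ {x | ∀ j, 0 ≤ x (.inr j)} ∩ {x | x (.inl 0) = 0} ∩
        {x | ∑ j, x (.inl j) + ∑ j, x (.inr j) = 1} ∩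
        {x | ∑ j : Fin (Ks + 1), x (.inl j) * ((j : ℕ) : ℝ) +
          ∑ j : Fin (Ks + 1), x (.inr j) * (((j : ℕ) : ℝ) + 1) ≤ ρ} ∩
        {x | Kh = 0 → ∀ j, x (.inr j) = 0} := by
      ext x
      exact ⟨fun h => ⟨⟨⟨⟨⟨h.1, h.2⟩, h.3⟩, h.4⟩, h.5⟩, h.6⟩,
        fun ⟨⟨⟨⟨⟨h1, h2⟩, h3⟩, h4⟩, h5⟩, h6⟩ => ⟨h1, h2, h3, h4, h5, h6⟩⟩
    rw [this]
    refine IsClosed.inter (IsClosed.inter (IsClosed.inter (IsClosed.inter (IsClosed.inter ?_ ?_)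
      ?_) ?_) ?_) ?_
    · simp only [Set.ofPred_forall]
      exact isClosed_iInter fun j => isClosed_le continuous_const (continuous_apply _)
    · simp only [Set.ofPred_forall]
      exact isClosed_iInter fun j => isClosed_le continuous_const (continuous_apply _)
    · exact isClosed_eq (continuous_apply _) continuous_const
    · exact isClosed_eq (by fun_prop) continuous_const
    · exact isClosed_le (by fun_prop) continuous_const
    · simp only [Set.ofPred_forall]
      exact isClosed_iInter fun _ => isClosed_iInter fun j =>
        isClosed_eq (continuous_apply _) continuous_const
  · intro x hx
    have hA := Finset.sum_nonneg fun j (_ : j ∈ univ) => hx.a_nonneg j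
    have hB := Finset.sum_nonneg fun j (_ : j ∈ univ) => hx.b_nonneg j
    have hsum := hx.sum_eq
    refine ⟨?_, ?_⟩
    · rintro (j | j)
      · exact hx.a_nonneg j
      · exact hx.b_nonneg j
    · rintro (j | j)
      · have := Finset.single_le_sum (fun j _ => hx.a_nonneg j) (Finset.mem_univ j)
        simp only [Pi.one_apply]
        linarith
      · have := Finset.single_le_sum (fun j _ => hx.b_nonneg j) (Finset.mem_univ j)
        simp only [Pi.one_apply]
        linarith

/-- For given numbers of nodes, some mixture with rational fractions is the fastest. -/
theorem exists_rational_mixture {Ks Kh N M Q : ℕ} {cm cs cr : ℝ}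
    (hne : ∃ a b, IsMixture Ks Kh ((M : ℝ) / N) a b) :
    ∃ a b : Fin (Ks + 1) → ℝ, IsMixture Ks Kh ((M : ℝ) / N) a b ∧
      (∀ a' b', IsMixture Ks Kh ((M : ℝ) / N) a' b' →
        mixtureTime Ks Kh Q cm cs cr a b ≤ mixtureTime Ks Kh Q cm cs cr a' b') ∧
      (∀ j, ∃ q : ℚ, a j = q) ∧ ∀ j, ∃ q : ℚ, b j = q := by
  obtain ⟨a₀, b₀, h₀⟩ := hne
  obtain ⟨x, hx, hmin, hrat⟩ := exists_rational_minimiser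
    (f := fun x => mixtureTime Ks Kh Q cm cs cr (fun j => x (.inl j)) fun j => x (.inr j))
    (isCompact_mixtures Ks Kh ((M : ℝ) / N)) ⟨Sum.elim a₀ b₀, h₀⟩ (by unfold mixtureTime; fun_prop)
    (by
      intro x hx φ hφ
      obtain ⟨D, hD⟩ := mixtureTime_eventually_perturb Ks Kh Q cm cs cr
        (fun j => x (.inl j)) (fun j => x (.inr j)) φ
      exact ⟨D, (hx.eventually_perturb hφ).and hD⟩)
  exact ⟨_, _, hx, fun a' b' h' => hmin (Sum.elim a' b') h', fun j => hrat _, fun j => hrat _⟩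

end Rational

/-! ### Schemes are no faster than their mixtures -/

lemma sum_card_fiber_mul {α κ : Type*} [Fintype κ] [DecidableEq κ] (I : Finset α) (c : α → κ)
    (f : κ → ℝ) : ∑ j, (#{n ∈ I | c n = j} : ℝ) * f j = ∑ n ∈ I, f (c n) := by
  rw [← Finset.sum_fiberwise I c]
  refine Finset.sum_congr rfl fun j _ => ?_
  rw [Finset.sum_congr rfl (g := fun _ => f j) fun n hn => by rw [(Finset.mem_filter.1 hn).2],
    Finset.sum_const, nsmul_eq_mul]

namespace Scheme

variable {K N M Q V s : ℕ} (σ : Scheme K N M Q V s)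

lemma solverCount_le (n : Fin N) : σ.solverCount n ≤ #σ.solvers :=
  Finset.card_le_card (Finset.filter_subset _ _)

lemma sum_solverCount : ∑ n, σ.solverCount n = ∑ k ∈ σ.solvers, #(σ.files k) := by
  simp only [solverCount, Finset.card_filter]
  rw [Finset.sum_comm]
  refine Finset.sum_congr rfl fun k _ => ?_
  rw [← Finset.card_filter]
  simp

lemma sum_helperCount_le : ∑ n, σ.helperCount n ≤ ∑ k ∈ σ.solversᶜ, #(σ.files k) := by
  have h : ∀ n, σ.helperCount n ≤ #{k ∈ σ.solversᶜ | n ∈ σ.files k} := by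
    intro n
    unfold helperCount
    split_ifs with h
    · obtain ⟨k, hk, hn⟩ := h
      exact Finset.card_pos.2 ⟨k, by simp [hk, hn]⟩
    · exact Nat.zero_le _
  refine (Finset.sum_le_sum fun n _ => h n).trans (le_of_eq ?_)
  simp only [Finset.card_filter]
  rw [Finset.sum_comm]
  refine Finset.sum_congr rfl fun k _ => ?_
  rw [← Finset.card_filter]
  simp

lemma one_le_count (n : Fin N) : 1 ≤ σ.solverCount n + σ.helperCount n := by
  obtain ⟨k, hk⟩ := σ.files_cover n
  by_cases hks : k ∈ σ.solvers
  · have : 0 < σ.solverCount n := Finset.card_pos.2 ⟨k, by simp [hks, hk]⟩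
    omega
  · have : σ.helperCount n = 1 := if_pos ⟨k, hks, hk⟩
    omega

lemma helperCount_eq (n : Fin N) (h : σ.helperCount n ≠ 0) : σ.helperCount n = 1 := by
  unfold helperCount at h ⊢
  split_ifs with h'
  · rfl
  · simp [h'] at h

/-- The number of solvers mapping a file, as an index of file types. -/
def fileType (n : Fin N) : Fin (#σ.solvers + 1) :=
  ⟨σ.solverCount n, Nat.lt_succ_of_le (σ.solverCount_le n)⟩

/-- The fraction of files mapped by `j` solvers and no other node. -/
noncomputable def typeA (j : Fin (#σ.solvers + 1)) : ℝ :=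
  (#{n ∈ univ.filter fun n => σ.helperCount n = 0 | σ.fileType n = j} : ℝ) / N

/-- The fraction of files mapped by `j` solvers and some other node. -/
noncomputable def typeB (j : Fin (#σ.solvers + 1)) : ℝ :=
  (#{n ∈ univ.filter fun n => ¬σ.helperCount n = 0 | σ.fileType n = j} : ℝ) / N

lemma sum_typeA_mul (f : ℕ → ℝ) : ∑ j, σ.typeA j * f j =
    (∑ n with σ.helperCount n = 0, f (σ.solverCount n)) / N := by
  simp only [typeA, div_mul_eq_mul_div, ← Finset.sum_div]
  rw [sum_card_fiber_mul _ _ fun j : Fin (#σ.solvers + 1) => f j]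
  rfl

lemma sum_typeB_mul (f : ℕ → ℝ) : ∑ j, σ.typeB j * f j =
    (∑ n with ¬σ.helperCount n = 0, f (σ.solverCount n)) / N := by
  simp only [typeB, div_mul_eq_mul_div, ← Finset.sum_div]
  rw [sum_card_fiber_mul _ _ fun j : Fin (#σ.solvers + 1) => f j]
  rfl

/-- Sums over the two kinds of types combine into sums over the files. -/
lemma sum_typeA_add_sum_typeB (f g : ℕ → ℝ) (F : Fin N → ℝ)
    (hf : ∀ n, σ.helperCount n = 0 → f (σ.solverCount n) = F n)
    (hg : ∀ n, σ.helperCount n = 1 → g (σ.solverCount n) = F n) :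
    ∑ j, σ.typeA j * f j + ∑ j, σ.typeB j * g j = (∑ n, F n) / N := by
  rw [sum_typeA_mul, sum_typeB_mul, ← add_div,
    ← Finset.sum_filter_add_sum_filter_not univ fun n => σ.helperCount n = 0]
  congr 2
  · exact Finset.sum_congr rfl fun n hn => hf n (Finset.mem_filter.1 hn).2
  · exact Finset.sum_congr rfl fun n hn =>
      hg n (σ.helperCount_eq n (Finset.mem_filter.1 hn).2)

lemma isMixture (hN : 1 ≤ N) :
    IsMixture (#σ.solvers) (K - #σ.solvers) ((M : ℝ) / N) σ.typeA σ.typeB := by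
  have hN0 : (0 : ℝ) < N := by exact_mod_cast hN
  refine ⟨fun j => by unfold typeA; positivity, fun j => by unfold typeB; positivity,
    ?_, ?_, ?_, ?_⟩
  · unfold typeA
    rw [Finset.filter_eq_empty_iff.2]
    · simp
    · intro n hn h
      have h1 := σ.one_le_count n
      rw [(Finset.mem_filter.1 hn).2] at h1
      have h2 : σ.solverCount n = 0 := congrArg Fin.val h
      omega
  · have h := σ.sum_typeA_add_sum_typeB (fun _ => 1) (fun _ => 1) (fun _ => 1)
      (fun _ _ => rfl) (fun _ _ => rfl)
    simpa [hN0.ne'] using h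
  · rw [σ.sum_typeA_add_sum_typeB (fun j => j) (fun j => j + 1)
      (fun n => ((σ.solverCount n + σ.helperCount n : ℕ) : ℝ)) (fun n h => by simp [h])
      (fun n h => by simp [h])]
    gcongr
    rw [← Nat.cast_sum, Finset.sum_add_distrib, σ.sum_solverCount]
    have h1 := σ.sum_helperCount_le
    have h2 := σ.storage
    rw [← Finset.sum_add_sum_compl σ.solvers] at h2
    exact_mod_cast (by omega)
  · intro hK j
    have huniv : σ.solvers = univ := by
      refine Finset.eq_univ_of_card _ (le_antisymm (Finset.card_le_univ _) ?_)
      rw [Fintype.card_fin]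
      omega
    unfold typeB
    rw [Finset.filter_eq_empty_iff.2]
    · simp
    · intro n hn
      refine absurd ?_ (Finset.mem_filter.1 hn).2
      simp [helperCount, huniv]

end Scheme

/-- The converse: the mixture of file types of a scheme is at least as fast as the scheme. -/
theorem Scheme.mixtureTime_le_execTime {K N M Q V : ℕ} (σ : Scheme K N M Q V 1) (hN : 1 ≤ N)
    (hQ : 1 ≤ Q) (hV : 1 ≤ V) {cm cs cr : ℝ} (hcm : 0 < cm) (hcs : 0 < cs) (hcr : 0 < cr) :
    mixtureTime (#σ.solvers) (K - #σ.solvers) Q cm cs cr σ.typeA σ.typeB ≤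
      σ.execTime cm cs cr := by
  have hN0 : (0 : ℝ) < N := by exact_mod_cast hN
  have hQ0 : (0 : ℝ) < Q := by exact_mod_cast hQ
  have hV0 : (0 : ℝ) < V := by exact_mod_cast hV
  obtain ⟨k₀, hk₀⟩ := σ.reduce_symmetric.nonempty hQ
  have hKs : 0 < #σ.solvers := Finset.card_pos.2 ⟨k₀, hk₀⟩
  have hKs0 : (0 : ℝ) < #σ.solvers := by exact_mod_cast hKs
  have hsup : ∀ k, #(σ.files k) ≤ univ.sup fun k => #(σ.files k) := fun k =>
    Finset.le_sup (f := fun k => #(σ.files k)) (Finset.mem_univ k)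
  have hpeak : max ((∑ j, σ.typeA j * (j : ℕ) + ∑ j, σ.typeB j * (j : ℕ)) / #σ.solvers)
      ((∑ j, σ.typeB j) / (K - #σ.solvers : ℕ)) ≤ σ.peakLoad := by
    unfold peakLoad
    refine max_le ?_ ?_
    · rw [σ.sum_typeA_add_sum_typeB (fun j => j) (fun j => j) (fun n => (σ.solverCount n : ℝ))
        (fun _ _ => rfl) (fun _ _ => rfl), div_div, mul_comm, ← div_div]
      gcongr
      rw [div_le_iff₀ hKs0]
      have h : ∑ n, σ.solverCount n ≤ (univ.sup fun k => #(σ.files k)) * #σ.solvers := by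
        rw [σ.sum_solverCount, mul_comm, ← smul_eq_mul]
        exact Finset.sum_le_card_nsmul _ _ _ fun k _ => hsup k
      exact_mod_cast h
    · have hB : ∑ j, σ.typeB j = (∑ n, (σ.helperCount n : ℝ)) / N := by
        have h := σ.sum_typeA_add_sum_typeB (fun _ => 0) (fun _ => 1)
          (fun n => (σ.helperCount n : ℝ)) (fun n h => by simp [h]) (fun n h => by simp [h])
        simpa using h
      rw [hB, div_div, mul_comm, ← div_div]
      gcongr
      refine div_le_of_le_mul₀ (Nat.cast_nonneg _) (Nat.cast_nonneg _) ?_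
      have h : ∑ n, σ.helperCount n ≤ (univ.sup fun k => #(σ.files k)) * (K - #σ.solvers) := by
        refine σ.sum_helperCount_le.trans ?_
        have hc : #σ.solversᶜ = K - #σ.solvers := by rw [Finset.card_compl, Fintype.card_fin]
        rw [mul_comm, ← smul_eq_mul, ← hc]
        exact Finset.sum_le_card_nsmul _ _ _ fun k _ => hsup k
      exact_mod_cast h
  have hcomm : ∑ j, σ.typeA j * load1 (#σ.solvers) (j : ℕ) +
      ∑ j, σ.typeB j * load2 (#σ.solvers) (j : ℕ) ≤ σ.commLoad := by
    rw [σ.sum_typeA_add_sum_typeB (fun j => load1 (#σ.solvers) j) (fun j => load2 (#σ.solvers) j)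
      (fun n => 1 / ((σ.solverCount n : ℝ) + σ.helperCount n) *
        (1 - σ.solverCount n / #σ.solvers)) (fun n h => by simp [load1, h])
      (fun n h => by simp [load2, h])]
    unfold commLoad
    rw [div_le_div_iff₀ hN0 (by positivity)]
    have h := σ.sum_len_ge
    have e : (V : ℝ) * ∑ n, ((#σ.solvers : ℝ) - σ.solverCount n) * ((Q : ℝ) / #σ.solvers) /
        (σ.solverCount n + σ.helperCount n) = (∑ n, 1 / ((σ.solverCount n : ℝ) + σ.helperCount n) *
        (1 - σ.solverCount n / #σ.solvers)) * (Q * V) := by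
      rw [mul_comm, Finset.sum_mul, Finset.sum_mul]
      refine Finset.sum_congr rfl fun n _ => ?_
      have : (0 : ℝ) < σ.solverCount n + σ.helperCount n := by exact_mod_cast σ.one_le_count n
      field_simp
    rw [e] at h
    calc _ = (∑ n, 1 / ((σ.solverCount n : ℝ) + σ.helperCount n) *
        (1 - σ.solverCount n / #σ.solvers)) * (Q * V) * N := by ring
      _ ≤ _ := mul_le_mul_of_nonneg_right h hN0.le
  have hred : (Q : ℝ) / #σ.solvers ≤ (univ.sup fun k => #(σ.reduce k) : ℕ) := by
    rw [div_le_iff₀ hKs0]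
    have h : #(σ.reduce k₀) ≤ univ.sup fun k => #(σ.reduce k) :=
      Finset.le_sup (f := fun k => #(σ.reduce k)) (Finset.mem_univ k₀)
    have h' := Nat.mul_le_mul_right (#σ.solvers) h
    rw [σ.reduce_symmetric.card_mul hk₀] at h'
    exact_mod_cast h'
  unfold mixtureTime execTime
  have h1 := mul_le_mul_of_nonneg_left hpeak hcm.le
  have h2 := mul_le_mul_of_nonneg_left hcomm hcs.le
  have h3 := mul_le_mul_of_nonneg_left hred hcr.le
  linarith

/-! ### Coded delivery -/

/-- A node assignment and messages on an arbitrary type of files give a scheme, provided that each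
message depends only on what its sender has mapped and that the messages determine the demands. -/
lemma exists_scheme {K N M Q V s : ℕ} {Φ : Type*} [Fintype Φ] (hΦ : Fintype.card Φ = N)
    (files : Fin K → Finset Φ) (hcov : ∀ n, ∃ k, n ∈ files k) (hst : ∑ k, #(files k) ≤ M)
    {S : Finset (Fin K)} {W : Fin K → Finset (Fin Q)} (hsym : IsWeaklySymmetric s S W)
    (μ : Fin K → Type*) [∀ k, Fintype (μ k)] (msg : ∀ k, (Fin Q → Φ → Bits V) → μ k → Bool)
    (hloc : ∀ k v v', (∀ q, ∀ n ∈ files k, v q n = v' q n) → msg k v = msg k v')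
    (hdec : ∀ k, ∀ q ∈ W k, ∀ v v', (∀ q, ∀ n ∈ files k, v q n = v' q n) →
      (∀ i, msg i v = msg i v') → ∀ n, v q n = v' q n) :
    ∃ σ : Scheme K N M Q V s, (∀ k, #(σ.files k) = #(files k)) ∧ σ.reduce = W ∧
      ∀ k, σ.len k = Fintype.card (μ k) := by
  classical
  let e : Φ ≃ Fin N := Fintype.equivFinOfCardEq hΦ
  let enc : (k : Fin K) → (Fin Q → {n // n ∈ (files k).map e.toEmbedding} → Bits V) →
      Bits (Fintype.card (μ k)) := fun k d i =>
    msg k (fun q n =>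
        if h : e n ∈ (files k).map e.toEmbedding then d q ⟨e n, h⟩ else fun _ => false)
      ((Fintype.equivFin (μ k)).symm i)
  have henc : ∀ k (v : Fin Q → Fin N → Bits V), enc k (fun q n => v q n) =
      fun i => msg k (fun q n => v q (e n)) ((Fintype.equivFin (μ k)).symm i) := by
    intro k v
    funext i
    refine congrFun (hloc k _ _ fun q n hn => ?_) _
    have hmem : e n ∈ (files k).map e.toEmbedding := Finset.mem_map_of_mem e.toEmbedding hn
    exact dif_pos hmem
  refine ⟨⟨fun k => (files k).map e.toEmbedding, fun n => ?_, by simpa using hst, S, W, hsym,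
    fun k => Fintype.card (μ k), enc, fun t k q hq => ?_⟩, fun k => Finset.card_map _, rfl,
    fun k => rfl⟩
  · obtain ⟨k, hk⟩ := hcov (e.symm n)
    exact ⟨k, Finset.mem_map.2 ⟨_, hk, by simp⟩⟩
  · -- It suffices that the demand is determined; the decoder picks any compatible file contents.
    let own : (Fin N → Bits t.F) → Fin Q → {n // n ∈ (files k).map e.toEmbedding} → Bits V :=
      fun ω q' n => t.interm ω q' n
    let heard : (Fin N → Bits t.F) → (i : Fin K) → Bits (Fintype.card (μ i)) :=
      fun ω i => enc i fun q' n => t.interm ω q' n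
    have key : ∀ ω ω', own ω = own ω' → heard ω = heard ω' → t.output ω q = t.output ω' q := by
      intro ω ω' h1 h2
      unfold Task.output
      congr 1
      funext n
      have h3 := hdec k q hq (fun q n => t.interm ω q (e n)) (fun q n => t.interm ω' q (e n))
        (fun q' n hn => congrFun (congrFun h1 q') ⟨e n, Finset.mem_map_of_mem e.toEmbedding hn⟩)
        (fun i => by
          have h4 : enc i (fun q' n => t.interm ω q' n) = enc i (fun q' n => t.interm ω' q' n) :=
            congrFun h2 i
          rw [henc, henc] at h4
          funext x
          simpa using congrFun h4 (Fintype.equivFin (μ i) x)) (e.symm n)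
      simpa using h3
    refine ⟨fun p m => if h : ∃ ω, own ω = p ∧ heard ω = m then t.output h.choose q
      else fun _ => false, fun ω => ?_⟩
    have hex : ∃ ω', own ω' = own ω ∧ heard ω' = heard ω := ⟨ω, rfl, rfl⟩
    exact (dif_pos hex).trans (key _ _ hex.choose_spec.1 hex.choose_spec.2)

/-- Assigning each function to one owner in `S`, with equally many functions per owner. -/
lemma isWeaklySymmetric_of_owner {K Q : ℕ} {S : Finset (Fin K)} (own : Fin Q → Fin K)
    (hS : ∀ q, own q ∈ S) (hcard : ∀ k ∈ S, #{q | own q = k} * #S = Q) :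
    IsWeaklySymmetric 1 S fun k => {q | own q = k} := by
  refine ⟨fun P => {q | own q ∈ P}, fun P hP => ?_, fun P hP P' hP' hne => ?_, ?_, fun k => ?_⟩
  · obtain ⟨hPS, h1⟩ := Finset.mem_powersetCard.1 hP
    obtain ⟨k, rfl⟩ := Finset.card_eq_one.1 h1
    simpa using hcard k (by simpa using hPS)
  · obtain ⟨-, h1⟩ := Finset.mem_powersetCard.1 hP
    obtain ⟨-, h1'⟩ := Finset.mem_powersetCard.1 hP'
    obtain ⟨k, rfl⟩ := Finset.card_eq_one.1 h1
    obtain ⟨l, rfl⟩ := Finset.card_eq_one.1 h1'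
    rw [Finset.disjoint_left]
    intro q hq hq'
    simp only [mem_filter, mem_univ, true_and, mem_singleton] at hq hq'
    exact hne (by rw [← hq, hq'])
  · refine Finset.eq_univ_of_forall fun q => Finset.mem_biUnion.2 ⟨{own q}, ?_, by simp⟩
    exact Finset.mem_powersetCard.2 ⟨by simpa using hS q, by simp⟩
  · ext q
    simp only [mem_filter, mem_univ, true_and, mem_biUnion, mem_powersetCard]
    constructor
    · rintro rfl
      exact ⟨{own q}, ⟨⟨by simpa using hS q, by simp⟩, by simp⟩, by simp⟩
    · rintro ⟨P, ⟨⟨-, h1⟩, hk⟩, hq⟩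
      obtain ⟨l, rfl⟩ := Finset.card_eq_one.1 h1
      rw [Finset.mem_singleton.1 hk, Finset.mem_singleton.1 hq]

section Coded

variable {K : ℕ} (S H : Finset (Fin K)) (A B : ℕ → ℕ)

/-- The number of files assigned to the solvers in `T` and designated to the sender `x`, which is
one of these solvers or a helper: `A #T` in the first case and `B #T` in the second. -/
def fileCount (T : Finset (Fin K)) (x : Fin K) : ℕ :=
  if T ⊆ S then if x ∈ T then A #T else if x ∈ H then B #T else 0 else 0

/-- The files: the `c`-th file assigned to the solvers in `T` and designated to the sender `x`. -/
abbrev CodedFile : Type :=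
  Σ p : Finset (Fin K) × Fin K, Fin (fileCount S H A B p.1 p.2)

/-- The number of coded packets sent by `x` for the group `U` of solvers. -/
def packetCount (U : Finset (Fin K)) (x : Fin K) : ℕ :=
  if U ⊆ S ∧ U.Nonempty then
    if x ∈ U then A (#U - 1) else if x ∈ H then B (#U - 1) else 0 else 0

/-- The files mapped by node `k`: those assigned to it as a solver or designated to it. -/
def codedFiles (k : Fin K) : Finset (CodedFile S H A B) := {n | k ∈ n.1.1 ∨ k = n.1.2}

variable {S H A B} {Q V w : ℕ}

/-- Bit `b` of the intermediate value of function `q` on the `c`-th file assigned to `T` and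
designated to `x`; `false` if there is no such file. -/
def fileBit (v : Fin Q → CodedFile S H A B → Bits V) (q : Fin Q) (T : Finset (Fin K)) (x : Fin K)
    (c : ℕ) (b : Fin V) : Bool :=
  if h : c < fileCount S H A B T x then v q ⟨(T, x), ⟨c, h⟩⟩ b else false

/-- The message of node `x`: for each group `U` of solvers, each `c`, each rank `i` of a function
and each bit position, the exclusive or over `k ∈ U`, `k ≠ x`, of the bits that `k` demands from the
`c`-th file assigned to `U \ {k}` and designated to `x`. -/
def codedMessage (fn : Fin K → Fin w → Fin Q) (x : Fin K) (v : Fin Q → CodedFile S H A B → Bits V) :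
    ((Σ U : Finset (Fin K), Fin (packetCount S H A B U x)) × Fin w × Fin V) → Bool :=
  fun i => ∑ k ∈ i.1.1.erase x, fileBit v (fn k i.2.1) (i.1.1.erase k) x i.1.2 i.2.2

lemma fileBit_congr {v v' : Fin Q → CodedFile S H A B → Bits V} {k : Fin K}
    (h : ∀ q, ∀ n ∈ codedFiles S H A B k, v q n = v' q n) {T : Finset (Fin K)} {x : Fin K}
    (hk : k ∈ T ∨ k = x) (q : Fin Q) (c : ℕ) (b : Fin V) :
    fileBit v q T x c b = fileBit v' q T x c b := by
  unfold fileBit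
  split_ifs with hc
  · rw [h q]
    simpa [codedFiles] using hk
  · rfl

lemma codedMessage_congr (fn : Fin K → Fin w → Fin Q) {x : Fin K}
    {v v' : Fin Q → CodedFile S H A B → Bits V}
    (h : ∀ q, ∀ n ∈ codedFiles S H A B x, v q n = v' q n) :
    codedMessage fn x v = codedMessage fn x v' := by
  funext i
  exact Finset.sum_congr rfl fun k _ => fileBit_congr h (Or.inr rfl) _ _ _

/-- Decoding: in the packet for the group `T ∪ {k}`, all terms but the one demanded by `k` are
known to `k`. -/
lemma coded_decode (fn : Fin K → Fin w → Fin Q) {k : Fin K} (hk : k ∈ S) {i : Fin w}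
    {v v' : Fin Q → CodedFile S H A B → Bits V}
    (h : ∀ q, ∀ n ∈ codedFiles S H A B k, v q n = v' q n)
    (hm : ∀ x, codedMessage fn x v = codedMessage fn x v') (n : CodedFile S H A B) :
    v (fn k i) n = v' (fn k i) n := by
  obtain ⟨⟨T, x⟩, c⟩ := n
  by_cases hkn : k ∈ T ∨ k = x
  · exact h _ _ (by simpa [codedFiles] using hkn)
  push Not at hkn
  obtain ⟨hkT, hkx⟩ := hkn
  have hTS : T ⊆ S := by
    by_contra hT
    have := c.2
    simp [fileCount, hT] at this
  have hcount : packetCount S H A B (insert k T) x = fileCount S H A B T x := by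
    have h1 : insert k T ⊆ S ∧ (insert k T).Nonempty :=
      ⟨Finset.insert_subset hk hTS, Finset.insert_nonempty _ _⟩
    rw [packetCount, fileCount, if_pos h1, if_pos hTS, Finset.card_insert_of_notMem hkT]
    simp [hkx.symm]
  funext b
  have h1 := congrFun (hm x) (⟨insert k T, ⟨c, by rw [hcount]; exact c.2⟩⟩, i, b)
  have hmem : k ∈ (insert k T).erase x := by simp [hkx]
  simp only [codedMessage] at h1
  rw [← Finset.add_sum_erase _ _ hmem, ← Finset.add_sum_erase _ _ hmem] at h1
  have h2 : ∀ l ∈ ((insert k T).erase x).erase k,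
      fileBit v (fn l i) ((insert k T).erase l) x c b =
        fileBit v' (fn l i) ((insert k T).erase l) x c b := by
    intro l hl
    refine fileBit_congr h (Or.inl ?_) _ _ _
    simp [(Finset.ne_of_mem_erase hl).symm]
  rw [Finset.sum_congr rfl h2] at h1
  have h3 := add_right_cancel h1
  rw [Finset.erase_insert hkT] at h3
  simpa [fileBit] using h3

end Coded

/-! ### The loads of coded delivery -/

section Count

variable {K : ℕ} {S H : Finset (Fin K)} {A B : ℕ → ℕ}

lemma card_sigma_fin_filter {ι : Type*} [Fintype ι] (c : ι → ℕ) (P : ι → Prop) [DecidablePred P] :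
    #{n : Σ i, Fin (c i) | P n.1} = ∑ i, if P i then c i else 0 := by
  have : ({n : Σ i, Fin (c i) | P n.1} : Finset _) =
      (univ.filter P).sigma fun _ => (univ : Finset (Fin (c _))) := by
    ext n
    simp
  rw [this, Finset.card_sigma, Finset.sum_filter]
  simp

/-- The designated senders for the solvers in `T` are these solvers and all helpers. -/
lemma sum_sender (hSH : Disjoint S H) {T : Finset (Fin K)} (hT : T ⊆ S) (a b : ℕ) :
    ∑ x, (if x ∈ T then a else if x ∈ H then b else 0) = #T * a + #H * b := by
  have h : ∀ x, (if x ∈ T then a else if x ∈ H then b else 0) =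
      (if x ∈ T then a else 0) + if x ∈ H then b else 0 := by
    intro x
    by_cases hx : x ∈ T
    · have : x ∉ H := Finset.disjoint_left.1 hSH (hT hx)
      simp [hx, this]
    · simp [hx]
  simp only [h, Finset.sum_add_distrib]
  simp [Finset.sum_ite_mem]

lemma sum_fileCount (hSH : Disjoint S H) (T : Finset (Fin K)) :
    ∑ x, fileCount S H A B T x = if T ⊆ S then #T * A #T + #H * B #T else 0 := by
  unfold fileCount
  split_ifs with hT
  · exact sum_sender hSH hT _ _
  · simp

lemma sum_packetCount (hSH : Disjoint S H) (U : Finset (Fin K)) :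
    ∑ x, packetCount S H A B U x =
      if U ⊆ S ∧ U.Nonempty then #U * A (#U - 1) + #H * B (#U - 1) else 0 := by
  unfold packetCount
  split_ifs with hU
  · exact sum_sender hSH hU.1 _ _
  · simp

lemma sum_subset_ite (S : Finset (Fin K)) (f : Finset (Fin K) → ℕ) :
    ∑ T, (if T ⊆ S then f T else 0) = ∑ T ∈ S.powerset, f T := by
  rw [← Finset.sum_filter]
  congr 1
  ext T
  simp

lemma card_codedFile (hSH : Disjoint S H) : Fintype.card (CodedFile S H A B) =
    ∑ j ∈ range (#S + 1), (#S).choose j * (j * A j + #H * B j) := by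
  rw [Fintype.card_sigma]
  simp only [Fintype.card_fin]
  rw [Fintype.sum_prod_type]
  simp only [sum_fileCount hSH]
  rw [sum_subset_ite, Finset.sum_powerset_apply_card fun j => j * A j + #H * B j]
  rfl

lemma card_codedFiles_solver (hSH : Disjoint S H) {k : Fin K} (hk : k ∈ S) :
    #S * #(codedFiles S H A B k) =
      ∑ j ∈ range (#S + 1), (#S).choose j * j * (j * A j + #H * B j) := by
  have hkH : k ∉ H := Finset.disjoint_left.1 hSH hk
  have h1 : #(codedFiles S H A B k) =
      ∑ T, if T ⊆ S then (if k ∈ T then #T * A #T + #H * B #T else 0) else 0 := by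
    unfold codedFiles
    rw [card_sigma_fin_filter (fun p : Finset (Fin K) × Fin K => fileCount S H A B p.1 p.2)
      fun p => k ∈ p.1 ∨ k = p.2, Fintype.sum_prod_type]
    refine Finset.sum_congr rfl fun T _ => ?_
    by_cases hkT : k ∈ T
    · simp only [hkT, true_or, if_true]
      exact sum_fileCount hSH T
    · simp only [hkT, false_or, if_false, ite_self]
      refine Finset.sum_eq_zero fun x _ => ?_
      split_ifs with h
      · subst h
        simp [fileCount, hkT, hkH]
      · rfl
  have hS : #S = #(S.erase k) + 1 := (Finset.card_erase_add_one hk).symm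
  rw [h1, sum_subset_ite, ← Finset.insert_erase hk, Finset.sum_powerset_insert
    (Finset.notMem_erase k S)]
  have h2 : ∑ T ∈ (S.erase k).powerset, (if k ∈ T then #T * A #T + #H * B #T else 0) = 0 := by
    refine Finset.sum_eq_zero fun T hT => if_neg fun hkT => ?_
    exact Finset.notMem_erase k S (Finset.mem_powerset.1 hT hkT)
  have h3 : ∀ T ∈ (S.erase k).powerset, (if k ∈ insert k T then
      #(insert k T) * A #(insert k T) + #H * B #(insert k T) else 0) =
      (#T + 1) * A (#T + 1) + #H * B (#T + 1) := by
    intro T hT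
    rw [if_pos (Finset.mem_insert_self _ _), Finset.card_insert_of_notMem fun hkT =>
      Finset.notMem_erase k S (Finset.mem_powerset.1 hT hkT)]
  rw [h2, zero_add, Finset.sum_congr rfl h3,
    Finset.sum_powerset_apply_card fun j => (j + 1) * A (j + 1) + #H * B (j + 1),
    Finset.insert_erase hk, Finset.sum_range_succ' _ #S, Finset.mul_sum]
  simp only [mul_zero, zero_mul, add_zero, smul_eq_mul]
  rw [← hS]
  refine Finset.sum_congr rfl fun j _ => ?_
  rw [← mul_assoc]
  congr 1
  rw [hS]
  exact Nat.add_one_mul_choose_eq _ _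

lemma card_codedFiles_helper (hSH : Disjoint S H) {k : Fin K} (hk : k ∈ H) :
    #(codedFiles S H A B k) = ∑ j ∈ range (#S + 1), (#S).choose j * B j := by
  have hkS : k ∉ S := Finset.disjoint_right.1 hSH hk
  have h1 : #(codedFiles S H A B k) = ∑ T, if T ⊆ S then B #T else 0 := by
    unfold codedFiles
    rw [card_sigma_fin_filter (fun p : Finset (Fin K) × Fin K => fileCount S H A B p.1 p.2)
      fun p => k ∈ p.1 ∨ k = p.2, Fintype.sum_prod_type]
    refine Finset.sum_congr rfl fun T _ => ?_
    by_cases hT : T ⊆ S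
    · have hkT : k ∉ T := fun h => hkS (hT h)
      simp [fileCount, hT, hkT, hk]
    · simp [fileCount, hT]
  rw [h1, sum_subset_ite, Finset.sum_powerset_apply_card]
  rfl

lemma card_codedFiles_other {k : Fin K} (hkS : k ∉ S) (hkH : k ∉ H) :
    #(codedFiles S H A B k) = 0 := by
  rw [Finset.card_eq_zero]
  refine Finset.filter_eq_empty_iff.2 ?_
  rintro ⟨⟨T, x⟩, c⟩ - h
  have hc := c.2
  by_cases hT : T ⊆ S
  · have hkT : k ∉ T := fun h => hkS (hT h)
    obtain rfl : k = x := by simpa [hkT] using h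
    simp [fileCount, hkT, hkH] at hc
  · simp [fileCount, hT] at hc

lemma sum_card_codedFiles (hSH : Disjoint S H) : ∑ k, #(codedFiles S H A B k) =
    ∑ j ∈ range (#S + 1), (#S).choose j * j * (j * A j + #H * B j) +
      #H * ∑ j ∈ range (#S + 1), (#S).choose j * B j := by
  have h1 : ∑ k, #(codedFiles S H A B k) = ∑ k ∈ S, #(codedFiles S H A B k) +
      ∑ k ∈ H, #(codedFiles S H A B k) := by
    rw [← Finset.sum_union hSH]
    symm
    refine Finset.sum_subset (Finset.subset_univ _) fun k _ hk => ?_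
    rw [Finset.mem_union, not_or] at hk
    exact card_codedFiles_other hk.1 hk.2
  rw [h1, Finset.sum_congr rfl fun k hk => card_codedFiles_helper hSH hk, Finset.sum_const,
    smul_eq_mul]
  congr 1
  rcases S.eq_empty_or_nonempty with rfl | hS
  · simp
  · refine Nat.eq_of_mul_eq_mul_left hS.card_pos ?_
    rw [Finset.mul_sum, Finset.sum_congr rfl fun k hk => card_codedFiles_solver hSH hk,
      Finset.sum_const, smul_eq_mul]

lemma sum_card_packets (hSH : Disjoint S H) (w V : ℕ) :
    ∑ x, Fintype.card ((Σ U : Finset (Fin K), Fin (packetCount S H A B U x)) × Fin w × Fin V) =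
      (∑ j ∈ range #S, (#S).choose (j + 1) * ((j + 1) * A j + #H * B j)) * (w * V) := by
  simp only [Fintype.card_prod, Fintype.card_sigma, Fintype.card_fin]
  rw [← Finset.sum_mul, Finset.sum_comm]
  congr 1
  simp only [sum_packetCount hSH]
  have h : ∀ U : Finset (Fin K), (if U ⊆ S ∧ U.Nonempty then #U * A (#U - 1) + #H * B (#U - 1)
      else 0) = if U ⊆ S then (if #U = 0 then 0 else #U * A (#U - 1) + #H * B (#U - 1)) else 0 := by
    intro U
    by_cases h1 : U ⊆ S <;> by_cases h2 : U = ∅ <;> simp [h1, h2, Finset.nonempty_iff_ne_empty]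
  simp only [h]
  rw [sum_subset_ite, Finset.sum_powerset_apply_card fun j =>
    if j = 0 then 0 else j * A (j - 1) + #H * B (j - 1), Finset.sum_range_succ' _ #S]
  simp

end Count

/-- The scheme of coded delivery. -/
theorem exists_coded_scheme {K N M Q V w : ℕ} {S H : Finset (Fin K)} (hSH : Disjoint S H)
    (hQ : 1 ≤ Q) (hw : #S * w = Q) (A B : ℕ → ℕ)
    (hN : ∑ j ∈ range (#S + 1), (#S).choose j * (j * A j + #H * B j) = N)
    (hM : ∑ j ∈ range (#S + 1), (#S).choose j * j * (j * A j + #H * B j) +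
      #H * ∑ j ∈ range (#S + 1), (#S).choose j * B j ≤ M) :
    ∃ σ : Scheme K N M Q V 1,
      (∀ k, #S * #(σ.files k) ≤
          ∑ j ∈ range (#S + 1), (#S).choose j * j * (j * A j + #H * B j) ∨
        #(σ.files k) = ∑ j ∈ range (#S + 1), (#S).choose j * B j ∧ 0 < #H) ∧
      (∀ k, #(σ.reduce k) ≤ w) ∧
      ∑ k, σ.len k =
        (∑ j ∈ range #S, (#S).choose (j + 1) * ((j + 1) * A j + #H * B j)) * (w * V) := by
  let ε : Fin Q ≃ S × Fin w := Fintype.equivOfCardEq (by simp [hw])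
  let own : Fin Q → Fin K := fun q => (ε q).1
  let fn : Fin K → Fin w → Fin Q := fun k i => if h : k ∈ S then ε.symm (⟨k, h⟩, i) else ⟨0, hQ⟩
  have hfn : ∀ q, fn (own q) (ε q).2 = q := by
    intro q
    have h : own q ∈ S := (ε q).1.2
    simp only [fn, dif_pos h]
    exact ε.symm_apply_apply q
  have hown : ∀ k ∈ S, #{q | own q = k} = w := by
    intro k hk
    have : ({q | own q = k} : Finset (Fin Q)) =
        univ.map ⟨fun i => ε.symm (⟨k, hk⟩, i), fun i j h => by simpa using h⟩ := by
      ext q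
      simp only [mem_filter, mem_univ, true_and, mem_map]
      constructor
      · rintro rfl
        exact ⟨(ε q).2, ε.symm_apply_apply q⟩
      · rintro ⟨i, rfl⟩
        change ((ε (ε.symm (⟨k, hk⟩, i))).1 : Fin K) = k
        rw [ε.apply_symm_apply]
    rw [this, Finset.card_map, Finset.card_univ, Fintype.card_fin]
  have hown' : ∀ k ∉ S, #{q | own q = k} = 0 := by
    intro k hk
    rw [Finset.card_eq_zero]
    exact Finset.filter_eq_empty_iff.2 fun q _ h => hk (h ▸ (ε q).1.2)
  have hsym : IsWeaklySymmetric 1 S fun k => ({q | own q = k} : Finset (Fin Q)) :=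
    isWeaklySymmetric_of_owner own (fun q => (ε q).1.2) fun k hk => by rw [hown k hk, mul_comm, hw]
  obtain ⟨σ, hfiles, hred, hlen⟩ := exists_scheme (V := V) (M := M)
    ((card_codedFile (A := A) (B := B) hSH).trans hN) (codedFiles S H A B)
    (fun n => ⟨n.1.2, by simp [codedFiles]⟩) (by rwa [sum_card_codedFiles hSH]) hsym
    (fun x => (Σ U : Finset (Fin K), Fin (packetCount S H A B U x)) × Fin w × Fin V)
    (codedMessage fn) (fun x v v' h => codedMessage_congr fn h)
    (fun k q hq v v' h hm n => by
      obtain rfl : own q = k := by simpa using hq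
      have := coded_decode fn (ε q).1.2 (i := (ε q).2) h hm n
      rwa [hfn] at this)
  refine ⟨σ, fun k => ?_, fun k => ?_, ?_⟩
  · rw [hfiles]
    by_cases hkS : k ∈ S
    · exact Or.inl (card_codedFiles_solver hSH hkS).le
    · by_cases hkH : k ∈ H
      · exact Or.inr ⟨card_codedFiles_helper hSH hkH, Finset.card_pos.2 ⟨k, hkH⟩⟩
      · rw [card_codedFiles_other hkS hkH]
        exact Or.inl (Nat.zero_le _)
  · rw [hred]
    by_cases hkS : k ∈ S
    · exact (hown k hkS).le
    · exact (hown' k hkS).le.trans (Nat.zero_le _)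
  · simp only [hlen]
    exact sum_card_packets hSH w V

/-! ### Rational mixtures are achieved -/

/-- Common denominators of finitely many nonnegative rationals. -/
lemma exists_common_denominator {ι : Type*} [Fintype ι] (x : ι → ℝ) (h0 : ∀ i, 0 ≤ x i)
    (hx : ∀ i, ∃ q : ℚ, x i = q) : ∃ D : ℕ, 1 ≤ D ∧ ∀ i, ∃ n : ℕ, (D : ℝ) * x i = n := by
  choose q hq using hx
  refine ⟨∏ i, (q i).den, Finset.prod_pos fun i _ => (q i).den_pos, fun i => ?_⟩
  obtain ⟨k, hk⟩ := Finset.dvd_prod_of_mem (fun i => (q i).den) (Finset.mem_univ i)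
  have hnum : 0 ≤ (q i).num := Rat.num_nonneg.2 (by exact_mod_cast hq i ▸ h0 i)
  refine ⟨k * (q i).num.toNat, ?_⟩
  have h1 : ((q i).num.toNat : ℝ) = ((q i).num : ℝ) := by
    exact_mod_cast congrArg (Int.cast : ℤ → ℝ) (Int.toNat_of_nonneg hnum)
  have h2 : ((q i).den : ℝ) * q i = (q i).num := by
    exact_mod_cast Rat.den_mul_eq_num (q i)
  rw [hk, hq]
  push_cast
  rw [h1, ← h2]
  ring

/-- Numbers of files per group and sender realising the fractions of a rational mixture. -/
lemma IsMixture.exists_counts {Ks Kh N : ℕ} {ρ : ℝ} {a b : Fin (Ks + 1) → ℝ}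
    (h : IsMixture Ks Kh ρ a b) (ha : ∀ j, ∃ q : ℚ, a j = q) (hb : ∀ j, ∃ q : ℚ, b j = q) :
    ∃ m₀ : ℕ, 1 ≤ m₀ ∧ ∀ m, m₀ ∣ m → ∃ A B : ℕ → ℕ, A 0 = 0 ∧
      (∀ j : Fin (Ks + 1), (Ks.choose j : ℝ) * ((j : ℕ) * A j) = a j * (m * N : ℕ)) ∧
      ∀ j : Fin (Ks + 1), (Ks.choose j : ℝ) * (Kh * B j) = b j * (m * N : ℕ) := by
  obtain ⟨D, hD, hn⟩ := exists_common_denominator (ι := Fin (Ks + 1) ⊕ Fin (Ks + 1))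
    (Sum.elim (fun j => a j / ((Ks.choose j : ℝ) * (j : ℕ)))
      fun j => b j / ((Ks.choose j : ℝ) * Kh))
    (by
      rintro (j | j)
      · exact div_nonneg (h.a_nonneg j) (by positivity)
      · exact div_nonneg (h.b_nonneg j) (by positivity))
    (by
      rintro (j | j)
      · obtain ⟨q, hq⟩ := ha j
        exact ⟨q / ((Ks.choose j : ℚ) * (j : ℕ)), by simp [hq]⟩
      · obtain ⟨q, hq⟩ := hb j
        exact ⟨q / ((Ks.choose j : ℚ) * Kh), by simp [hq]⟩)
  choose n hn using hn
  have hA : ∀ j, (D : ℝ) * (a j / ((Ks.choose j : ℝ) * (j : ℕ))) = n (.inl j) :=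
    fun j => hn (.inl j)
  have hB : ∀ j, (D : ℝ) * (b j / ((Ks.choose j : ℝ) * Kh)) = n (.inr j) := fun j => hn (.inr j)
  have hc : ∀ j : Fin (Ks + 1), (Ks.choose j : ℝ) ≠ 0 := fun j => by
    exact_mod_cast (Nat.choose_pos (Nat.lt_succ_iff.1 j.2)).ne'
  refine ⟨D, hD, ?_⟩
  rintro m ⟨t, rfl⟩
  refine ⟨fun j => if hj : j < Ks + 1 then t * N * n (.inl ⟨j, hj⟩) else 0,
    fun j => if hj : j < Ks + 1 then t * N * n (.inr ⟨j, hj⟩) else 0, ?_, fun j => ?_, fun j => ?_⟩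
  · have h0 := hA 0
    rw [h.a_zero, zero_div, mul_zero] at h0
    have h1 : n (.inl 0) = 0 := by exact_mod_cast h0.symm
    change (if hj : 0 < Ks + 1 then t * N * n (.inl ⟨0, hj⟩) else 0) = 0
    rw [dif_pos (Nat.succ_pos _)]
    exact mul_eq_zero_of_right _ h1
  · simp only [Fin.is_lt, dif_pos, Fin.eta]
    push_cast
    rw [← hA j]
    by_cases hj : j = 0
    · simp [hj, h.a_zero]
    · have hj0 : ((j : ℕ) : ℝ) ≠ 0 := Nat.cast_ne_zero.2 fun e => hj (Fin.ext e)
      have := hc j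
      field_simp
  · simp only [Fin.is_lt, dif_pos, Fin.eta]
    push_cast
    rw [← hB j]
    by_cases hj : Kh = 0
    · simp [hj, h.no_helper hj j]
    · have hj0 : (Kh : ℝ) ≠ 0 := by exact_mod_cast hj
      have := hc j
      field_simp

/-- The length of the messages of coded delivery, in terms of the loads. -/
lemma sum_choose_succ_mul_eq {Ks Kh : ℕ} (hKs : 1 ≤ Ks) {a b : Fin (Ks + 1) → ℝ} {x : ℝ}
    {A B : ℕ → ℕ} (hA0 : A 0 = 0) (ha0 : a 0 = 0)
    (hA : ∀ j : Fin (Ks + 1), (Ks.choose j : ℝ) * ((j : ℕ) * A j) = a j * x)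
    (hB : ∀ j : Fin (Ks + 1), (Ks.choose j : ℝ) * (Kh * B j) = b j * x) :
    ∑ j ∈ range Ks, (Ks.choose (j + 1) : ℝ) * (((j : ℝ) + 1) * A j + Kh * B j) =
      x * Ks * (∑ j, a j * load1 Ks (j : ℕ) + ∑ j, b j * load2 Ks (j : ℕ)) := by
  have hKs0 : (Ks : ℝ) ≠ 0 := by exact_mod_cast (by omega : Ks ≠ 0)
  have h1 : ∑ j ∈ range Ks, (Ks.choose (j + 1) : ℝ) * (((j : ℝ) + 1) * A j + Kh * B j) =
      ∑ j ∈ range (Ks + 1), (Ks.choose (j + 1) : ℝ) * (((j : ℝ) + 1) * A j + Kh * B j) := by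
    rw [Finset.sum_range_succ]
    simp
  rw [h1, Finset.sum_range, ← Finset.sum_add_distrib, Finset.mul_sum]
  refine Finset.sum_congr rfl fun j _ => ?_
  have hj1 : ((j : ℕ) : ℝ) + 1 ≠ 0 := by positivity
  have hc : (Ks.choose ((j : ℕ) + 1) : ℝ) * ((j : ℕ) + 1) = Ks.choose j * (Ks - (j : ℕ)) := by
    rw [← Nat.cast_sub (Nat.lt_succ_iff.1 j.2)]
    exact_mod_cast Nat.choose_succ_right_eq Ks j
  have e1 : (Ks.choose ((j : ℕ) + 1) : ℝ) * (((j : ℕ) + 1) * A j) =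
      x * Ks * (a j * load1 Ks (j : ℕ)) := by
    by_cases hj : j = 0
    · subst hj
      simp [hA0, ha0]
    · have hj0 : ((j : ℕ) : ℝ) ≠ 0 := Nat.cast_ne_zero.2 fun e => hj (Fin.ext e)
      calc _ = (Ks.choose ((j : ℕ) + 1) : ℝ) * ((j : ℕ) + 1) * A j := by ring
        _ = (Ks.choose j * ((j : ℕ) * A j)) * (Ks - (j : ℕ)) / (j : ℕ) := by
          rw [hc]
          field_simp
        _ = _ := by
          rw [hA, load1]
          field_simp
  have e2 : (Ks.choose ((j : ℕ) + 1) : ℝ) * (Kh * B j) = x * Ks * (b j * load2 Ks (j : ℕ)) := by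
    calc _ = (Ks.choose ((j : ℕ) + 1) : ℝ) * ((j : ℕ) + 1) * (Kh * B j) / ((j : ℕ) + 1) := by
          field_simp
      _ = (Ks.choose j * (Kh * B j)) * (Ks - (j : ℕ)) / ((j : ℕ) + 1) := by
          rw [hc]
          ring
      _ = _ := by
          rw [hB, load2]
          field_simp
  rw [mul_add, e1, e2]
  ring

/-- Achievability: some multiple of the number of files suffices for every rational mixture. -/
theorem IsMixture.exists_scheme {K N M Q Ks Kh : ℕ} {cm cs cr : ℝ} {a b : Fin (Ks + 1) → ℝ}
    (h : IsMixture Ks Kh ((M : ℝ) / N) a b) (ha : ∀ j, ∃ q : ℚ, a j = q)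
    (hb : ∀ j, ∃ q : ℚ, b j = q) (hK : Ks + Kh ≤ K) (hKs : 1 ≤ Ks) (hdvd : Ks ∣ Q) (hQ : 1 ≤ Q)
    (hN : 1 ≤ N) (hcm : 0 < cm) (hcr : 0 < cr) :
    ∃ m₀ : ℕ, 1 ≤ m₀ ∧ ∀ m V : ℕ, 1 ≤ m → m₀ ∣ m → 1 ≤ V →
      ∃ σ : Scheme K (m * N) (m * M) Q V 1,
        σ.execTime cm cs cr ≤ mixtureTime Ks Kh Q cm cs cr a b := by
  obtain ⟨m₀, hm₀, hcounts⟩ := h.exists_counts (N := N) ha hb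
  refine ⟨m₀, hm₀, fun m V hm hdm hV => ?_⟩
  obtain ⟨A, B, hA0, hA, hB⟩ := hcounts m hdm
  obtain ⟨S, -, rfl⟩ := Finset.exists_subset_card_eq (s := (univ : Finset (Fin K))) (n := Ks)
    (by rw [Finset.card_univ, Fintype.card_fin]; omega)
  obtain ⟨H, hHS, rfl⟩ := Finset.exists_subset_card_eq (s := Sᶜ) (n := Kh)
    (by rw [Finset.card_compl, Fintype.card_fin]; omega)
  have hSH : Disjoint S H := (Finset.subset_compl_iff_disjoint_left.1 hHS)
  obtain ⟨w, hw⟩ := hdvd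
  have hx : (0 : ℝ) < (m * N : ℕ) := by exact_mod_cast Nat.mul_pos hm hN
  have hm0 : (0 : ℝ) < m := by exact_mod_cast hm
  have hN0 : (0 : ℝ) < N := by exact_mod_cast hN
  have hS0 : (0 : ℝ) < #S := by exact_mod_cast hKs
  have hV0 : (0 : ℝ) < V := by exact_mod_cast hV
  have hQ0 : (0 : ℝ) < Q := by exact_mod_cast hQ
  -- The four sums that describe the scheme, as real numbers.
  have htotal : ((∑ j ∈ range (#S + 1), (#S).choose j * (j * A j + #H * B j) : ℕ) : ℝ) =
      (m * N : ℕ) := by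
    rw [Nat.cast_sum, Finset.sum_range]
    push_cast [mul_add, Finset.sum_add_distrib]
    rw [Finset.sum_congr rfl fun j _ => hA j, Finset.sum_congr rfl fun j _ => hB j,
      ← Finset.sum_mul, ← Finset.sum_mul, ← add_mul, h.sum_eq]
    push_cast
    ring
  have hsolver : ((∑ j ∈ range (#S + 1), (#S).choose j * j * (j * A j + #H * B j) : ℕ) : ℝ) =
      (m * N : ℕ) * (∑ j, a j * (j : ℕ) + ∑ j, b j * (j : ℕ)) := by
    rw [Nat.cast_sum, Finset.sum_range, ← Finset.sum_add_distrib, Finset.mul_sum]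
    refine Finset.sum_congr rfl fun j _ => ?_
    have h1 := hA j
    have h2 := hB j
    push_cast at h1 h2 ⊢
    linear_combination (j : ℕ) * h1 + (j : ℕ) * h2
  have hhelper : (#H : ℝ) * (∑ j ∈ range (#S + 1), (#S).choose j * B j : ℕ) =
      (m * N : ℕ) * ∑ j, b j := by
    rw [Nat.cast_sum, Finset.sum_range, Finset.mul_sum, Finset.mul_sum]
    refine Finset.sum_congr rfl fun j _ => ?_
    have h2 := hB j
    push_cast at h2 ⊢
    linear_combination h2
  have hlength : ((∑ j ∈ range #S, (#S).choose (j + 1) * ((j + 1) * A j + #H * B j) : ℕ) : ℝ) =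
      (m * N : ℕ) * #S * (∑ j, a j * load1 (#S) (j : ℕ) + ∑ j, b j * load2 (#S) (j : ℕ)) := by
    rw [← sum_choose_succ_mul_eq hKs hA0 h.a_zero hA hB]
    push_cast
    rfl
  obtain ⟨σ, hfiles, hred, hlen⟩ := exists_coded_scheme (V := V) (M := m * M) hSH hQ hw.symm A B
    (by exact_mod_cast htotal) (by
      have h1 : ((∑ j ∈ range (#S + 1), (#S).choose j * j * (j * A j + #H * B j) +
          #H * ∑ j ∈ range (#S + 1), (#S).choose j * B j : ℕ) : ℝ) ≤ (m * M : ℕ) := by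
        rw [Nat.cast_add, hsolver, Nat.cast_mul #H, hhelper, ← mul_add]
        have hst := h.storage
        simp only [mul_add, mul_one, Finset.sum_add_distrib, ← add_assoc] at hst
        refine (mul_le_mul_of_nonneg_left hst hx.le).trans (le_of_eq ?_)
        push_cast
        field_simp
      exact_mod_cast h1)
  refine ⟨σ, ?_⟩
  have hpeak : σ.peakLoad ≤ max ((∑ j, a j * (j : ℕ) + ∑ j, b j * (j : ℕ)) / #S)
      ((∑ j, b j) / #H) := by
    have hne : (univ : Finset (Fin K)).Nonempty :=
      (Finset.card_pos.1 (by omega : 0 < #S)).mono (Finset.subset_univ _)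
    obtain ⟨k, -, hk⟩ := Finset.exists_mem_eq_sup univ hne fun k => #(σ.files k)
    unfold Scheme.peakLoad
    rw [hk]
    rcases hfiles k with h1 | ⟨h1, hH⟩
    · refine le_max_of_le_left ?_
      rw [div_le_div_iff₀ hx hS0]
      have h2 := (Nat.cast_le (α := ℝ)).2 h1
      rw [hsolver, Nat.cast_mul #S] at h2
      linarith
    · refine le_max_of_le_right ?_
      have hH0 : (0 : ℝ) < #H := by exact_mod_cast hH
      rw [h1, div_le_div_iff₀ hx hH0]
      linarith
  have hcomm : σ.commLoad =
      ∑ j, a j * load1 (#S) (j : ℕ) + ∑ j, b j * load2 (#S) (j : ℕ) := by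
    have hQ' : (Q : ℝ) = #S * w := by exact_mod_cast hw
    unfold Scheme.commLoad
    rw [div_eq_iff (by positivity), hlen, Nat.cast_mul, hlength, hQ']
    push_cast
    ring
  have hreduce : ((univ.sup fun k => #(σ.reduce k) : ℕ) : ℝ) ≤ (Q : ℝ) / #S := by
    rw [le_div_iff₀ hS0]
    have h1 : (univ.sup fun k => #(σ.reduce k)) * #S ≤ Q := by
      refine (Nat.mul_le_mul_right _ (Finset.sup_le fun k _ => hred k)).trans (le_of_eq ?_)
      rw [hw, mul_comm]
    exact_mod_cast h1
  unfold Scheme.execTime mixtureTime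
  rw [hcomm]
  have h1 := mul_le_mul_of_nonneg_left hpeak hcm.le
  have h3 := mul_le_mul_of_nonneg_left hreduce hcr.le
  linarith

/-! ### The minimum execution time -/

/-- One solver that maps every file, and no helper. -/
lemma feasible_single {K N M Q : ℕ} (hK : 1 ≤ K) (hN : 1 ≤ N) (hQ : 1 ≤ Q) (hM : N ≤ M) :
    Allocation.Feasible K N M Q { α := 1, r₁ := 1, r₂ := 0, Ks := 1, Kh := 0 } where
  nodes := hK
  one_le_Ks := Nat.le_refl 1
  Ks_le := hQ
  Ks_dvd := one_dvd Q
  storage := by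
    have hN0 : (0 : ℝ) < N := by exact_mod_cast hN
    simp only [mul_one, sub_self, zero_mul, add_zero]
    rw [le_div_iff₀ hN0, one_mul]
    exact_mod_cast hM
  α_nonneg := by norm_num
  α_le_one := by norm_num
  no_helper := fun _ => rfl
  one_le_r₁ := by norm_num
  r₁_le := by norm_num
  r₂_nonneg := by norm_num
  r₂_le := by norm_num

/-- The admissible numbers of solvers and helpers, for storage `ρ` per file. -/
def admissiblePairs (K Q : ℕ) (ρ : ℝ) : Set (ℕ × ℕ) :=
  {p | p.1 + p.2 ≤ K ∧ 1 ≤ p.1 ∧ p.1 ∣ Q ∧ ∃ a b, IsMixture p.1 p.2 ρ a b}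

lemma finite_admissiblePairs (K Q : ℕ) (ρ : ℝ) : (admissiblePairs K Q ρ).Finite := by
  refine ((Set.finite_Iic K).prod (Set.finite_Iic K)).subset fun p hp => ?_
  exact ⟨(Nat.le_add_right _ _).trans hp.1, (Nat.le_add_left _ _).trans hp.1⟩

/-- Among the admissible numbers of solvers and helpers and all their mixtures, some rational
mixture is the fastest. -/
theorem exists_fastest_mixture {K N M Q : ℕ} (hK : 1 ≤ K) (hN : 1 ≤ N) (hQ : 1 ≤ Q) (hM : N ≤ M)
    (cm cs cr : ℝ) :
    ∃ (Ks Kh : ℕ) (a b : Fin (Ks + 1) → ℝ), Ks + Kh ≤ K ∧ 1 ≤ Ks ∧ Ks ∣ Q ∧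
      IsMixture Ks Kh ((M : ℝ) / N) a b ∧ (∀ j, ∃ q : ℚ, a j = q) ∧ (∀ j, ∃ q : ℚ, b j = q) ∧
      ∀ (Ks' Kh' : ℕ) (a' b' : Fin (Ks' + 1) → ℝ), Ks' + Kh' ≤ K → 1 ≤ Ks' → Ks' ∣ Q →
        IsMixture Ks' Kh' ((M : ℝ) / N) a' b' →
        mixtureTime Ks Kh Q cm cs cr a b ≤ mixtureTime Ks' Kh' Q cm cs cr a' b' := by
  have hne : Nonempty (admissiblePairs K Q ((M : ℝ) / N)) := by
    obtain ⟨a, b, h, -⟩ := (feasible_single hK hN hQ hM).exists_mixture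
      (cm := 0) (cs := 0) (cr := 0)
    exact ⟨(1, 0), hK, Nat.le_refl 1, one_dvd _, a, b, h⟩
  have hfin : Finite (admissiblePairs K Q ((M : ℝ) / N)) := finite_admissiblePairs K Q _
  choose a b hmix hmin hA hB using fun p : admissiblePairs K Q ((M : ℝ) / N) =>
    exists_rational_mixture (Q := Q) (cm := cm) (cs := cs) (cr := cr) p.2.2.2.2
  obtain ⟨p, hp⟩ := Finite.exists_min fun p : admissiblePairs K Q ((M : ℝ) / N) =>
    mixtureTime p.1.1 p.1.2 Q cm cs cr (a p) (b p)
  refine ⟨p.1.1, p.1.2, a p, b p, p.2.1, p.2.2.1, p.2.2.2.1, hmix p, hA p, hB p, ?_⟩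
  intro Ks' Kh' a' b' h1 h2 h3 h4
  let p' : admissiblePairs K Q ((M : ℝ) / N) := ⟨(Ks', Kh'), h1, h2, h3, a', b', h4⟩
  exact (hp p').trans (hmin p' a' b' h4)

end MapReduce

theorem mainTheorem2 (K N M Q : ℕ) (hK : 1 ≤ K) (hN : 1 ≤ N) (hQ : 1 ≤ Q) (hM : N ≤ M)
    (cm cs cr : ℝ) (hcm : 0 < cm) (hcs : 0 < cs) (hcr : 0 < cr) :
    (∃ T : ℝ,
      IsLeast {x | ∃ a : MapReduce.Allocation, a.Feasible K N M Q ∧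
        x = a.time MapReduce.load1Env MapReduce.load2Env Q cm cs cr} T ∧
      (∀ m V : ℕ, 1 ≤ m → 1 ≤ V →
        T ∈ lowerBounds (MapReduce.achievableTimes K (m * N) (m * M) Q V 1 cm cs cr)) ∧
      ∃ m₀ : ℕ, 1 ≤ m₀ ∧ ∀ m V : ℕ, 1 ≤ m → m₀ ∣ m → 1 ≤ V →
        IsLeast (MapReduce.achievableTimes K (m * N) (m * M) Q V 1 cm cs cr) T) ∧
    ∀ a : MapReduce.Allocation, a.Feasible K N M Q →
      (∃ j : ℕ, a.r₁ = j) → (∃ j : ℕ, a.r₂ = j) →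
        a.time MapReduce.load1Env MapReduce.load2Env Q cm cs cr =
          a.time MapReduce.load1 MapReduce.load2 Q cm cs cr := by
  constructor
  · obtain ⟨Ks, Kh, a, b, hKK, hKs, hdvd, hmix, hrA, hrB, hmin⟩ :=
      MapReduce.exists_fastest_mixture hK hN hQ hM cm cs cr
    have hle : ∀ A : MapReduce.Allocation, A.Feasible K N M Q →
        MapReduce.mixtureTime Ks Kh Q cm cs cr a b ≤
          A.time MapReduce.load1Env MapReduce.load2Env Q cm cs cr := by
      intro A hA
      obtain ⟨a', b', h, heq⟩ := hA.exists_mixture (cm := cm) (cs := cs) (cr := cr)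
      exact heq ▸ hmin _ _ a' b' hA.nodes hA.one_le_Ks hA.Ks_dvd h
    have hlower : ∀ m V : ℕ, 1 ≤ m → 1 ≤ V → MapReduce.mixtureTime Ks Kh Q cm cs cr a b ∈
        lowerBounds (MapReduce.achievableTimes K (m * N) (m * M) Q V 1 cm cs cr) := by
      rintro m V hm hV x ⟨σ, rfl⟩
      have hmN : 1 ≤ m * N := Nat.mul_pos hm hN
      have hsol := σ.reduce_symmetric.nonempty hQ
      obtain ⟨k, hk⟩ := hsol
      have hcard : #σ.solvers ≤ K := by simpa using Finset.card_le_univ σ.solvers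
      have hρ : (((m * M : ℕ) : ℝ) / (m * N : ℕ)) = (M : ℝ) / N := by
        have hm0 : (m : ℝ) ≠ 0 := by exact_mod_cast (by omega : m ≠ 0)
        push_cast
        exact mul_div_mul_left _ _ hm0
      refine (hmin _ _ _ _ (by omega) (Finset.card_pos.2 ⟨k, hk⟩)
        (Dvd.intro_left _ (σ.reduce_symmetric.card_mul hk)) (hρ ▸ σ.isMixture hmN)).trans
        (σ.mixtureTime_le_execTime hmN hQ hV hcm hcs hcr)
    refine ⟨MapReduce.mixtureTime Ks Kh Q cm cs cr a b, ⟨?_, ?_⟩, hlower, ?_⟩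
    · obtain ⟨A, hA, hAt⟩ := hmix.exists_allocation (cm := cm) (cr := cr) hKK hKs hdvd hQ hcs
      exact ⟨A, hA, le_antisymm (hle A hA) hAt⟩
    · rintro x ⟨A, hA, rfl⟩
      exact hle A hA
    · obtain ⟨m₀, hm₀, hach⟩ := hmix.exists_scheme (cm := cm) (cs := cs) (cr := cr)
        hrA hrB hKK hKs hdvd hQ hN hcm hcr
      refine ⟨m₀, hm₀, fun m V hm hdm hV => ⟨?_, hlower m V hm hV⟩⟩
      obtain ⟨σ, hσ⟩ := hach m V hm hdm hV
      exact ⟨σ, le_antisymm hσ (hlower m V hm hV ⟨σ, rfl⟩)⟩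
  · rintro A hA ⟨i, hi⟩ ⟨j, hj⟩
    have h1 : 1 ≤ i := by exact_mod_cast hi ▸ hA.one_le_r₁
    have h2 : i ≤ A.Ks := by exact_mod_cast hi ▸ hA.r₁_le
    have h3 : j ≤ A.Ks := by exact_mod_cast hj ▸ hA.r₂_le
    simp only [MapReduce.Allocation.time, hi, hj, MapReduce.load1Env_natCast h1 h2,
      MapReduce.load2Env_natCast h3]
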